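/- **Setting.** A hidden state in $\{0,1\}$ jumps from $0$ to $1$ at rate $\lambda_0>0$ and from $1$ to $0$ at rate $\lambda_1>0$; put $\lambda=\lambda_0+\lambda_1$ and $\pi=\lambda_0/\lambda\in(0,1)$. A belief $p\in[0,1]$ is the probability of state $1$. Without information, a belief drifts as $p_t=e^{-\lambda t}p+(1-e^{-\lambda t})\pi$. Let $r,\kappa>0$, let $u:[0,1]\to\mathbb R$ be continuous, and let $c:[0,1]\to[0,\infty]$ be convex, finite and continuously differentiable on $(0,1)$. An information acquisition policy chooses, as measurable functions of the past beliefs, acquisition times $0\le\tau_1\le\tau_2\le\cdots\le\infty$ and experiments $F_1,F_2,\dots$, where $F_i$ is a probability distribution on $[0,1]$ whose mean is the belief $P_{\tau_i-}$ just before $\tau_i$. At $\tau_i<\infty$ the belief process $(P_t)$ jumps to a draw from $F_i$, and between acquisitions it drifts as above. The value function is $$v(p)=\sup\ \mathbb E\Big[\int_0^\infty e^{-rt}u(P_t)\,dt-\sum_{i\ge1}e^{-r\tau_i}\big(C(F_i)+\kappa\big)\Big],\qquad C(F)=\int c\,dF-c\Big(\int q\,dF(q)\Big),$$ where the supremum is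 over all policies started at belief $p$ (and $C(F)=0$ for the uninformative $F$). Let $w=v-c$ on $\{c<\infty\}$, let $\operatorname{Cav}w$ be its smallest concave majorant there, and let $$G=\{\operatorname{Cav}w-w>0\},\qquad I=\{\operatorname{Cav}w-w=\kappa\}\subseteq G .$$ The *optimal policy* waits until the belief hits $I$ (forever if it never does), and then acquires the binary experiment that is supported on the two closest beliefs, on either side of the current one, outside $G$. A *non-degenerate belief cycle* consists of targets $q^0,q^1\in[0,1]$, thresholds $p^0,p^1$ and waiting times $\tau^0,\tau^1$ with $q^0<p^0<\pi<p^1<q^1$ and $q^i_{\tau^i}=p^i$, i.e. $\tau^i=\frac1\lambda\log\frac{\pi-q^i}{\pi-p^i}$, for $i=0,1$. Beliefs *follow* it from time $T$ on if $P_T\in\{q^0,q^1\}$ and, whenever they are at $q^i$ (at $T$ or after an acquisition), they drift for the time $\tau^i$ to $p^i$ and then the binary experiment on $\{q^0,q^1\}$ with mean $p^i$ is acquired. **Theorem.** The optimal policy is well defined. For every initial belief $p\in[0,1]$, the belief process $(P_t)$ that it induces from $p$ has an almost surely finite random time $T\ge0$ such that one of the following holds: (A) almost surely, no information is acquired after $T$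 (and only finitely many acquisitions occur in total), and $P_t\to\pi$ as $t\to\infty$; or (B) there is a non-degenerate belief cycle, the same for almost all realizations, that almost surely the process $(P_t)$ follows from time $T$ on. -/

import Mathlib

open MeasureTheory ProbabilityTheory Filter Topology
open scoped NNReal ENNReal

noncomputable section

namespace InfoAcq

/-- A belief: the probability that the current state is `1`. -/
abbrev Belief : Type := Set.Icc (0 : ℝ) 1

/-- The primitives of the decision problem, with the standing assumptions. Only the values of
`u` and `c` on `[0, 1]` matter. -/
structure Model where
  /-- jump rate of the state from `0` to `1` -/
  rate0 : ℝ
  /-- jump rate of the state from `1` to `0` -/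
  rate1 : ℝ
  /-- discount rate -/
  r : ℝ
  /-- fixed cost of an information acquisition -/
  fixedCost : ℝ
  /-- indirect flow utility -/
  u : ℝ → ℝ
  /-- measure of certainty that generates the uniformly posterior separable cost -/
  c : ℝ → ℝ≥0∞
  rate0_pos : 0 < rate0
  rate1_pos : 0 < rate1
  r_pos : 0 < r
  fixedCost_pos : 0 < fixedCost
  u_cont : ContinuousOn u (Set.Icc 0 1)
  c_convex : ∀ x ∈ Set.Icc (0 : ℝ) 1, ∀ y ∈ Set.Icc (0 : ℝ) 1, ∀ a b : ℝ, 0 ≤ a → 0 ≤ b →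
    a + b = 1 → c (a * x + b * y) ≤ ENNReal.ofReal a * c x + ENNReal.ofReal b * c y
  c_finite : ∀ x ∈ Set.Ioo (0 : ℝ) 1, c x ≠ ⊤
  c_smooth : ContDiffOn ℝ 1 (fun x => (c x).toReal) (Set.Ioo 0 1)

namespace Model

variable (M : Model)

/-- Total transition rate of the state. -/
def rate : ℝ := M.rate0 + M.rate1

/-- Probability of state `1` under the invariant distribution. -/
def longRun : ℝ := M.rate0 / (M.rate0 + M.rate1)

theorem rate_pos : 0 < M.rate := add_pos M.rate0_pos M.rate1_pos

theorem longRun_mem : M.longRun ∈ Set.Icc (0 : ℝ) 1 := by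
  have h : 0 < M.rate0 + M.rate1 := M.rate_pos
  refine ⟨div_nonneg M.rate0_pos.le h.le, ?_⟩
  rw [longRun, div_le_one h]
  linarith [M.rate1_pos]

/-- The belief reached from `q` after a time `t` without information. -/
def drift (q : Belief) (t : ℝ≥0) : Belief :=
  ⟨Real.exp (-M.rate * t) * q + (1 - Real.exp (-M.rate * t)) * M.longRun, by
    have h1 : Real.exp (-M.rate * t) ≤ 1 := by
      rw [Real.exp_le_one_iff, neg_mul]
      exact neg_nonpos.2 (mul_nonneg M.rate_pos.le t.2)
    exact (convex_Icc (0 : ℝ) 1) q.2 M.longRun_mem (Real.exp_pos _).le (sub_nonneg.2 h1)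
      (by ring)⟩

/-- Variable cost of an experiment, `∫ c dF - c (mean of F)`. By convexity the difference is
nonnegative; where `c` is infinite at the mean, the mean is `0` or `1`, the experiment is
uninformative, and the cost is `0`. -/
def cost (F : Measure Belief) : ℝ≥0∞ :=
  (∫⁻ q, M.c q ∂F) - M.c (∫ q, (q : ℝ) ∂F)

/-- The discount factor at a time in `[0, ∞]`. -/
def discount (s : ℝ≥0∞) : ℝ≥0∞ :=
  if s = ⊤ then 0 else ENNReal.ofReal (Real.exp (-M.r * s.toReal))

end Model

/-- Histories of the initial belief and the first `n` posterior beliefs. -/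
abbrev History (n : ℕ) : Type := (i : Finset.Iic n) → Belief

/-- The current (most recent) belief of a history. -/
def History.last {n : ℕ} (h : History n) : Belief := h ⟨n, Finset.mem_Iic.2 le_rfl⟩

/-- An information acquisition policy: after the history of the initial belief and of the first
`n` posteriors, `wait n` is the waiting time (possibly `0`, possibly infinite) until the next
information acquisition, and `exper n` the experiment (law of the posterior) acquired then.
Experiments are Bayes plausible given the belief at the moment of acquisition. Where the waiting
time is infinite, the experiment plays no role. -/
structure Policy (M : Model) where
  wait : (n : ℕ) → History n → ℝ≥0∞
  measurable_wait : ∀ n, Measurable (wait n)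
  exper : (n : ℕ) → Kernel (History n) Belief
  markov : ∀ n, IsMarkovKernel (exper n)
  bayes : ∀ n h, wait n h ≠ ⊤ →
    ∫ q, (q : ℝ) ∂(exper n h) = (M.drift h.last (wait n h).toNNReal : ℝ)

attribute [instance] Policy.markov

namespace Policy

variable {M : Model} (ξ : Policy M)

/-- The law of the sequence (initial belief `p`, first posterior, second posterior, ...). -/
def law (p : Belief) : Measure (ℕ → Belief) :=
  Kernel.traj (X := fun _ => Belief) ξ.exper 0 (fun _ => p)

/-- The history of the first `n` posteriors along a realization. -/
def hist (ω : ℕ → Belief) (n : ℕ) : History n := fun i => ω i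

/-- The time of the `n`-th information acquisition; index `0` is the initial time `0`, at which
nothing is acquired (an immediate acquisition is a first one at time `0`). -/
def acqTime : ℕ → (ℕ → Belief) → ℝ≥0∞
  | 0, _ => 0
  | n + 1, ω => acqTime n ω + ξ.wait n (hist ω n)

/-- The belief process: drift from the most recent posterior. (If acquisition times accumulate at
a finite time, the value from there on is a convention without effect: total cost is infinite.) -/
def belief (ω : ℕ → Belief) (t : ℝ≥0) : Belief :=
  let N := sSup {n : ℕ | ξ.acqTime n ω ≤ t}
  M.drift (ω N) (t - (ξ.acqTime N ω).toNNReal)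

/-- Expected discounted flow utility. -/
def utility (p : Belief) : ℝ :=
  ∫ ω, (∫ t in Set.Ioi (0 : ℝ),
    Real.exp (-M.r * t) * M.u (ξ.belief ω t.toNNReal : ℝ)) ∂(ξ.law p)

/-- Expected discounted information costs, fixed and variable. -/
def totalCost (p : Belief) : ℝ≥0∞ :=
  ∫⁻ ω, (∑' n : ℕ, M.discount (ξ.acqTime (n + 1) ω) *
    (M.cost (ξ.exper n (hist ω n)) + ENNReal.ofReal M.fixedCost)) ∂(ξ.law p)

/-- Expected payoff of a policy from initial belief `p`. -/
def payoff (p : Belief) : EReal := (ξ.utility p : EReal) - (ξ.totalCost p : EReal)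

end Policy

/-- Concave envelope over `D` (smallest concave majorant on `D`) of `f`, at `p`. -/
def concaveEnvelope (D : Set ℝ) (f : Belief → ℝ) (p : Belief) : ℝ :=
  sInf {y | ∃ g : ℝ → ℝ, ConcaveOn ℝ D g ∧ (∀ q : Belief, (q : ℝ) ∈ D → f q ≤ g q) ∧ y = g p}

/-- `F` is the binary experiment supported on `a` and `b` that is Bayes plausible at `x`. -/
def IsBinaryExperiment (F : Measure Belief) (a b x : Belief) : Prop :=
  IsProbabilityMeasure F ∧ F ({a, b}ᶜ) = 0 ∧ ∫ q, (q : ℝ) ∂F = (x : ℝ)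

namespace Model

variable (M : Model)

/-- The value function of the optimal information acquisition problem. -/
def value (p : Belief) : ℝ := (⨆ ξ : Policy M, ξ.payoff p).toReal

/-- The set of beliefs at which `c` is finite: `[0, 1]`, except possibly for its endpoints. -/
def domain : Set ℝ := {x | x ∈ Set.Icc (0 : ℝ) 1 ∧ M.c x ≠ ⊤}

/-- The net value function `v - c` (meaningful on `domain`). -/
def netValue (p : Belief) : ℝ := M.value p - (M.c p).toReal

/-- The residual value of information, `Cav (v - c) - (v - c)` (meaningful on `domain`). -/
def residual (p : Belief) : ℝ :=
  concaveEnvelope M.domain M.netValue p - M.netValue p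

/-- Beliefs with a positive residual value of information. An endpoint at which `c` is infinite
admits only the uninformative experiment, so it does not belong. -/
def grossRegion : Set Belief := {p | (p : ℝ) ∈ M.domain ∧ 0 < M.residual p}

/-- The information acquisition region: the residual value of information equals the fixed
cost. -/
def acqRegion : Set Belief := {p | (p : ℝ) ∈ M.domain ∧ M.residual p = M.fixedCost}

/-- The time until the belief drifting from `q` hits the information acquisition region. -/
def hitTime (q : Belief) : ℝ≥0∞ :=
  ⨅ (t : ℝ≥0) (_ : M.drift q t ∈ M.acqRegion), (t : ℝ≥0∞)

end Model

/-- The optimal policy: wait until the belief hits the information acquisition region, then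
acquire the binary experiment supported on the two closest beliefs outside the region with
positive residual value of information. -/
def Policy.IsOptimalRule {M : Model} (ξ : Policy M) : Prop :=
  ∀ (n : ℕ) (h : History n), ξ.wait n h = M.hitTime h.last ∧
    (ξ.wait n h ≠ ⊤ → ∃ a b : Belief,
      IsGreatest {y : Belief | y ≤ M.drift h.last (ξ.wait n h).toNNReal ∧ y ∉ M.grossRegion} a ∧
      IsLeast {y : Belief | M.drift h.last (ξ.wait n h).toNNReal ≤ y ∧ y ∉ M.grossRegion} b ∧
      IsBinaryExperiment (ξ.exper n h) a b (M.drift h.last (ξ.wait n h).toNNReal))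

/-- A non-degenerate belief cycle: targets `q`, thresholds `p`, waiting times `s`. -/
structure BeliefCycle (M : Model) where
  q : Fin 2 → Belief
  p : Fin 2 → Belief
  s : Fin 2 → ℝ≥0
  q0_lt_p0 : q 0 < p 0
  p0_lt : (p 0 : ℝ) < M.longRun
  lt_p1 : M.longRun < (p 1 : ℝ)
  p1_lt_q1 : p 1 < q 1
  drift_eq : ∀ i, M.drift (q i) (s i) = p i

namespace Policy

variable {M : Model} (ξ : Policy M)

/-- Along `ω`, no information is acquired after time `T` (and only finitely often before). -/
def StopsAfter (T : ℝ≥0∞) (ω : ℕ → Belief) : Prop :=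
  ∃ N, ξ.acqTime N ω ≤ T ∧ ξ.acqTime (N + 1) ω = ⊤

/-- Along `ω`, from time `T` on (the time of an acquisition, or the initial time) the belief
process follows the cycle: it starts at a target `q i`, drifts to the threshold `p i` during the
waiting time `s i`, and then the Bayes plausible binary experiment on the two targets is acquired,
again and again. -/
def FollowsCycleFrom (C : BeliefCycle M) (T : ℝ≥0∞) (ω : ℕ → Belief) : Prop :=
  ∃ N, ξ.acqTime N ω = T ∧ T ≠ ⊤ ∧ ∀ n, N ≤ n → ∃ i : Fin 2,
    (∀ t : ℝ≥0, t < C.s i →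
      ξ.belief ω ((ξ.acqTime n ω).toNNReal + t) = M.drift (C.q i) t) ∧
    ξ.acqTime (n + 1) ω = ξ.acqTime n ω + C.s i ∧
    IsBinaryExperiment (ξ.exper n (hist ω n)) (C.q 0) (C.q 1) (C.p i)

end Policy

end InfoAcq

end

noncomputable section

namespace InfoAcq

/-! The argument needs no Bellman equation: of the value function `v` only its continuity
(`continuous_value`) enters. Given continuity, the residual value `Cav w - w` is continuous on the
open interval. Near an endpoint `b` it is small: `v` lies below an affine function close to `v b` at
`b`, and subtracting `c` turns this function into a concave majorant of `w` (`exists_residual_le`).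
Hence `G` is open and avoids the endpoints, while `I` is a compact subset of `G`. Closest beliefs
outside `G` therefore exist, the hitting time of `I` is attained, and the rule is well defined. By
compactness `I` meets only finitely many components of `G`, so there are finitely many possible
targets (`finite_ends`).

Between acquisitions the belief moves monotonically towards the long-run belief `π` and reaches it
in finite time only from `π` itself. If the component in which `I` is hit does not contain `π`, both
its ends lie weakly between the current posterior and `π`. The distance to `π` then either drops or
the posterior stays put, and with finitely many targets the sequence becomes constant
(`eventually_eq_or_hasCycle`). Being stuck forever at a target from which `I` is reached has
probability zero, since each experiment leaves it with probability bounded below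
(`ae_not_eventually_eq`). So almost surely either a posterior is reached from which `I` is never
hit, or the component of `π` is entered. In the latter case, if both ends lead back to `I` they form
the cycle, which is absorbing; if only one does, the other is eventually drawn and acquisition
stops.

The alternative is deterministic. When both ends of the component of `π` lead back to `I`, so does
every belief outside `G`, as it drifts through one of these ends (`HasCycle.hitTime_ne_top`);
acquisition then stops only if it never starts.

Continuity of `v` is proved by imitation. At interior beliefs, a nearly optimal first experiment
from `x` is mixed with a rare extra posterior to correct its mean, and so becomes available from `y`
(`le_value_of_mixture`). At an endpoint, a nearly optimal policy must wait first, since an immediate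
experiment is uninformative and wastes the fixed cost; nearby beliefs are reached by drifting from
the endpoint for a short time, so shifting time compares the values (`continuousAt_value_endpoint`).
-/

theorem History.measurable_last {n : ℕ} : Measurable (History.last (n := n)) :=
  measurable_pi_apply (X := fun _ : Finset.Iic n => Belief) _

/-! ### Laws of belief sequences and their uniqueness. -/

namespace Policy

variable {M : Model} (ξ : Policy M)

theorem measurable_hist (n : ℕ) : Measurable (fun ω : ℕ → Belief => hist ω n) :=
  measurable_pi_lambda _ fun _ => measurable_pi_apply _

instance isProbabilityMeasure_law (p : Belief) : IsProbabilityMeasure (ξ.law p) := by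
  unfold law; infer_instance

theorem law_map_hist (p : Belief) (n : ℕ) :
    (ξ.law p).map (fun ω => hist ω n) =
      Kernel.partialTraj (X := fun _ => Belief) ξ.exper 0 n (fun _ => p) :=
  Kernel.traj_map_frestrictLe_apply (X := fun _ => Belief) (κ := ξ.exper) 0 n _

theorem law_map_hist_succ (p : Belief) (n : ℕ) :
    (ξ.law p).map (fun ω => (hist ω n, ω (n + 1))) =
      (ξ.law p).map (fun ω => hist ω n) ⊗ₘ ξ.exper n := by
  rw [law_map_hist]
  exact (Kernel.partialTraj_compProd_eq_map_traj (X := fun _ => Belief) (κ := ξ.exper)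
    (Nat.zero_le n) (x₀ := fun _ => p)).symm

theorem law_start (p : Belief) : ∀ᵐ ω ∂(ξ.law p), ω 0 = p := by
  have h := ξ.law_map_hist p 0
  rw [Kernel.partialTraj_zero, Kernel.deterministic_apply] at h
  have h2 : ∀ᵐ y ∂((ξ.law p).map (fun ω => hist ω 0)), y.last = p := by
    rw [h]
    refine (ae_dirac_iff ?_).2 rfl
    exact History.measurable_last (measurableSet_singleton p)
  exact ae_of_ae_map (measurable_hist 0).aemeasurable h2

/-- A property of the next posterior that holds almost surely given every history holds almost
surely along realizations. -/
theorem law_ae_step (p : Belief) (n : ℕ) {S : Set (History n × Belief)} (hS : MeasurableSet S)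
    (h : ∀ y, ∀ᵐ q ∂(ξ.exper n y), (y, q) ∈ S) :
    ∀ᵐ ω ∂(ξ.law p), (hist ω n, ω (n + 1)) ∈ S := by
  have h1 : ∀ᵐ z ∂((ξ.law p).map (fun ω => (hist ω n, ω (n + 1)))), z ∈ S := by
    rw [law_map_hist_succ]
    exact (Measure.ae_compProd_iff hS).2 (ae_of_all _ h)
  exact ae_of_ae_map ((measurable_hist n).prodMk (measurable_pi_apply _)).aemeasurable h1

/-- `μ` is the law of a sequence of beliefs started at `p` whose transitions are the experiments
of `ξ`. -/
structure IsLaw (p : Belief) (μ : Measure (ℕ → Belief)) : Prop where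
  prob : IsProbabilityMeasure μ
  start : ∀ᵐ ω ∂μ, ω 0 = p
  step : ∀ n (A : Set (History n)) (B : Set Belief), MeasurableSet A → MeasurableSet B →
    μ {ω | hist ω n ∈ A ∧ ω (n + 1) ∈ B} = ∫⁻ ω in {ω | hist ω n ∈ A}, ξ.exper n (hist ω n) B ∂μ

theorem isLaw_law (p : Belief) : ξ.IsLaw p (ξ.law p) where
  prob := inferInstance
  start := ξ.law_start p
  step n A B hA hB := by
    have hm := measurable_hist n
    have hm2 : Measurable (fun ω : ℕ → Belief => (hist ω n, ω (n + 1))) :=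
      hm.prodMk (measurable_pi_apply _)
    have h : (ξ.law p) {ω | hist ω n ∈ A ∧ ω (n + 1) ∈ B} =
        ((ξ.law p).map (fun ω => (hist ω n, ω (n + 1)))) (A ×ˢ B) := by
      rw [Measure.map_apply hm2 (hA.prod hB)]; rfl
    rw [h, law_map_hist_succ, Measure.compProd_apply_prod hA hB,
      setLIntegral_map hA ((ξ.exper n).measurable_coe hB) hm]
    rfl

variable {ξ}

theorem IsLaw.map_hist_succ {p : Belief} {μ : Measure (ℕ → Belief)} (h : ξ.IsLaw p μ) (n : ℕ) :
    μ.map (fun ω => (hist ω n, ω (n + 1))) = μ.map (fun ω => hist ω n) ⊗ₘ ξ.exper n := by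
  have := h.prob
  have hm := measurable_hist n
  have hm2 : Measurable (fun ω : ℕ → Belief => (hist ω n, ω (n + 1))) :=
    hm.prodMk (measurable_pi_apply _)
  have : IsProbabilityMeasure (μ.map (fun ω => (hist ω n, ω (n + 1)))) :=
    Measure.isProbabilityMeasure_map hm2.aemeasurable
  have : IsProbabilityMeasure (μ.map (fun ω => hist ω n)) :=
    Measure.isProbabilityMeasure_map hm.aemeasurable
  refine Measure.ext_prod fun {A B} hA hB => ?_
  rw [Measure.map_apply hm2 (hA.prod hB), Measure.compProd_apply_prod hA hB,
    setLIntegral_map hA ((ξ.exper n).measurable_coe hB) hm]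
  exact h.step n A B hA hB

/-- The history of length `n + 1` assembled from one of length `n` and the next belief. -/
def extend {n : ℕ} (z : History n × Belief) : History (n + 1) := fun i =>
  if h : (i : ℕ) ≤ n then z.1 ⟨i, Finset.mem_Iic.2 h⟩ else z.2

theorem measurable_extend (n : ℕ) : Measurable (extend (n := n)) := by
  refine measurable_pi_lambda _ fun i => ?_
  unfold extend
  split_ifs with h
  · exact (measurable_pi_apply _).comp measurable_fst
  · exact measurable_snd

theorem extend_hist (ω : ℕ → Belief) (n : ℕ) :
    extend (hist ω n, ω (n + 1)) = hist ω (n + 1) := by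
  funext i
  unfold extend
  split_ifs with h
  · rfl
  · have : (i : ℕ) = n + 1 := le_antisymm (Finset.mem_Iic.1 i.2) (by omega)
    simp [hist, this]

theorem IsLaw.map_hist_eq {p : Belief} {μ ν : Measure (ℕ → Belief)} (hμ : ξ.IsLaw p μ)
    (hν : ξ.IsLaw p ν) (n : ℕ) :
    μ.map (fun ω => hist ω n) = ν.map (fun ω => hist ω n) := by
  have := hμ.prob
  have := hν.prob
  induction n with
  | zero =>
    have key : ∀ ρ : Measure (ℕ → Belief), IsProbabilityMeasure ρ → (∀ᵐ ω ∂ρ, ω 0 = p) →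
        ρ.map (fun ω => hist ω 0) = Measure.dirac (fun _ => p) := by
      intro ρ _ h
      have : (fun ω => hist ω 0) =ᵐ[ρ] fun _ => (fun _ => p) := by
        filter_upwards [h] with ω hω
        funext i
        have : (i : ℕ) = 0 := Nat.le_zero.1 (Finset.mem_Iic.1 i.2)
        simp [hist, this, hω]
      rw [Measure.map_congr this, Measure.map_const, measure_univ, one_smul]
    rw [key μ hμ.prob hμ.start, key ν hν.prob hν.start]
  | succ n ih =>
    have key : ∀ ρ : Measure (ℕ → Belief), ρ.map (fun ω => hist ω (n + 1)) =
        (ρ.map (fun ω => (hist ω n, ω (n + 1)))).map extend := by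
      intro ρ
      rw [Measure.map_map (measurable_extend n)
        ((measurable_hist n).prodMk (measurable_pi_apply _))]
      congr 1
      funext ω
      exact (extend_hist ω n).symm
    rw [key, key, hμ.map_hist_succ, hν.map_hist_succ, ih]

/-- The start and the transitions fix all laws of histories by induction, and every finite set of
indices lies in an initial segment, so projective limits are unique. Laws of modified policies are
identified below by checking `IsLaw` alone. -/
theorem IsLaw.eq_law {p : Belief} {μ : Measure (ℕ → Belief)} (hμ : ξ.IsLaw p μ) :
    μ = ξ.law p := by
  have := hμ.prob
  have h : ∀ I : Finset ℕ, μ.map I.restrict = (ξ.law p).map I.restrict := by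
    intro I
    have hI : I ⊆ Finset.Iic (I.sup id) := fun i hi => Finset.mem_Iic.2 (Finset.le_sup (f := id) hi)
    have key : ∀ ρ : Measure (ℕ → Belief), ρ.map I.restrict =
        (ρ.map (fun ω => hist ω (I.sup id))).map (Finset.restrict₂ (π := fun _ => Belief) hI) := by
      intro ρ
      exact (Measure.map_map (Finset.measurable_restrict₂ (X := fun _ => Belief) hI)
        (measurable_hist _)).symm
    rw [key, key, hμ.map_hist_eq (ξ.isLaw_law p)]
  have hμ' : IsProjectiveLimit μ (fun I : Finset ℕ => (ξ.law p).map I.restrict) := h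
  exact hμ'.unique fun _ => rfl

end Policy

/-! ### Drift, discounting and bounded flow utility. -/

namespace Model

variable (M : Model)

theorem coe_drift (q : Belief) (t : ℝ≥0) :
    (M.drift q t : ℝ) = M.longRun + Real.exp (-M.rate * t) * (q - M.longRun) := by
  simp only [drift]; ring

@[simp] theorem drift_zero (q : Belief) : M.drift q 0 = q := by
  apply Subtype.ext; simp [coe_drift]

theorem drift_add (q : Belief) (s t : ℝ≥0) : M.drift q (s + t) = M.drift (M.drift q s) t := by
  apply Subtype.ext
  simp only [coe_drift, NNReal.coe_add, mul_add, Real.exp_add]; ring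

theorem continuous_drift : Continuous (fun z : Belief × ℝ≥0 => M.drift z.1 z.2) := by
  refine Continuous.subtype_mk ?_ _
  fun_prop

theorem exists_utility_bound : ∃ B : ℝ, 0 ≤ B ∧ ∀ q : Belief, |M.u q| ≤ B := by
  obtain ⟨B, hB⟩ := isCompact_Icc.exists_bound_of_continuousOn M.u_cont
  refine ⟨B, (norm_nonneg _).trans (hB 0 ⟨le_rfl, zero_le_one⟩), fun q => hB q q.2⟩

/-- A bound for the absolute value of the flow utility. -/
def utilityBound : ℝ := M.exists_utility_bound.choose

theorem utilityBound_nonneg : 0 ≤ M.utilityBound := M.exists_utility_bound.choose_spec.1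

theorem abs_u_le (q : Belief) : |M.u q| ≤ M.utilityBound := M.exists_utility_bound.choose_spec.2 q

theorem continuous_u : Continuous (fun q : Belief => M.u q) :=
  continuousOn_iff_continuous_domRestrict.1 M.u_cont

theorem integrableOn_exp : IntegrableOn (fun t : ℝ => Real.exp (-M.r * t)) (Set.Ioi 0) :=
  integrableOn_exp_mul_Ioi (neg_neg_of_pos M.r_pos) 0

theorem integral_exp : ∫ t in Set.Ioi (0 : ℝ), Real.exp (-M.r * t) = 1 / M.r := by
  rw [integral_exp_mul_Ioi (neg_neg_of_pos M.r_pos)]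
  simp

theorem discount_top : M.discount ⊤ = 0 := by simp [discount]

theorem discount_le_one (s : ℝ≥0∞) : M.discount s ≤ 1 := by
  unfold discount
  split_ifs
  · exact zero_le_one
  · rw [ENNReal.ofReal_le_one, Real.exp_le_one_iff]
    nlinarith [M.r_pos, s.toReal_nonneg]

theorem discount_zero : M.discount 0 = 1 := by simp [discount]

theorem discount_add_coe (a : ℝ≥0∞) (s : ℝ≥0) :
    M.discount (a + s) = ENNReal.ofReal (Real.exp (-M.r * s)) * M.discount a := by
  unfold discount
  by_cases h : a = ⊤
  · simp [h]
  · rw [if_neg h, if_neg (by simp [h]), ← ENNReal.ofReal_mul (Real.exp_pos _).le,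
      ENNReal.toReal_add h ENNReal.coe_ne_top, ← Real.exp_add, ENNReal.coe_toReal]
    congr 2; ring

end Model

/-! ### The belief process, path utility and path cost. -/

namespace Policy

variable {M : Model} (ξ : Policy M)

theorem acqTime_succ (n : ℕ) (ω : ℕ → Belief) :
    ξ.acqTime (n + 1) ω = ξ.acqTime n ω + ξ.wait n (hist ω n) := rfl

theorem acqTime_mono (ω : ℕ → Belief) : Monotone fun n => ξ.acqTime n ω :=
  monotone_nat_of_le_succ fun n => by rw [acqTime_succ]; exact le_self_add

theorem measurable_acqTime (n : ℕ) : Measurable (ξ.acqTime n) := by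
  induction n with
  | zero => exact measurable_const
  | succ n ih => exact ih.add ((ξ.measurable_wait n).comp (measurable_hist n))

/-- The number of the most recent acquisition at a given time. -/
def index (ω : ℕ → Belief) (t : ℝ≥0) : ℕ := sSup {n : ℕ | ξ.acqTime n ω ≤ t}

theorem index_eq {ω : ℕ → Belief} {t : ℝ≥0} {n : ℕ} (h1 : ξ.acqTime n ω ≤ t)
    (h2 : (t : ℝ≥0∞) < ξ.acqTime (n + 1) ω) : ξ.index ω t = n := by
  have : {n : ℕ | ξ.acqTime n ω ≤ t} = Set.Iic n := by
    ext k
    simp only [Set.mem_ofPred_eq, Set.mem_Iic]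
    refine ⟨fun h => ?_, fun h => (ξ.acqTime_mono ω h).trans h1⟩
    by_contra hk
    exact absurd (h2.trans_le (ξ.acqTime_mono ω (show n + 1 ≤ k by omega))) (not_lt.2 h)
  rw [index, this, csSup_Iic]

/-- The supremum of an unbounded set of naturals is `0` by convention, so after an accumulation of
acquisitions the belief is the drift of the initial one. The pathwise comparisons below have to
treat this case. -/
theorem index_eq_zero {ω : ℕ → Belief} {t : ℝ≥0} (h : ∀ n, ξ.acqTime n ω ≤ t) :
    ξ.index ω t = 0 := by
  have : {n : ℕ | ξ.acqTime n ω ≤ t} = Set.univ := by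
    ext k; simp [h k]
  rw [index, this]
  exact Nat.sSup_of_not_bddAbove (not_bddAbove_univ)

theorem exists_index_or (ω : ℕ → Belief) (t : ℝ≥0) :
    (∃ n, ξ.acqTime n ω ≤ t ∧ (t : ℝ≥0∞) < ξ.acqTime (n + 1) ω) ∨ ∀ n, ξ.acqTime n ω ≤ t := by
  by_cases h : ∀ n, ξ.acqTime n ω ≤ t
  · exact Or.inr h
  · push Not at h
    left
    classical
    have h0 : Nat.find h ≠ 0 := by
      intro h0
      have := Nat.find_spec h
      rw [h0] at this
      simp [acqTime] at this
    obtain ⟨k, hk⟩ := Nat.exists_eq_succ_of_ne_zero h0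
    refine ⟨k, ?_, ?_⟩
    · exact not_lt.1 (Nat.find_min h (by omega : k < Nat.find h))
    · have := Nat.find_spec h
      rwa [hk] at this

theorem belief_eq_index (ω : ℕ → Belief) (t : ℝ≥0) : ξ.belief ω t =
    M.drift (ω (ξ.index ω t)) (t - (ξ.acqTime (ξ.index ω t) ω).toNNReal) := rfl

theorem belief_eq {ω : ℕ → Belief} {t : ℝ≥0} {n : ℕ} (h1 : ξ.acqTime n ω ≤ t)
    (h2 : (t : ℝ≥0∞) < ξ.acqTime (n + 1) ω) :
    ξ.belief ω t = M.drift (ω n) (t - (ξ.acqTime n ω).toNNReal) := by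
  rw [belief_eq_index, ξ.index_eq h1 h2]

theorem belief_eq_of_forall_le {ω : ℕ → Belief} {t : ℝ≥0} (h : ∀ n, ξ.acqTime n ω ≤ t) :
    ξ.belief ω t = M.drift (ω 0) t := by
  rw [belief_eq_index, ξ.index_eq_zero h]
  simp [acqTime]

theorem measurable_index : Measurable (fun z : (ℕ → Belief) × ℝ≥0 => ξ.index z.1 z.2) := by
  have hT : ∀ n, Measurable fun z : (ℕ → Belief) × ℝ≥0 => ξ.acqTime n z.1 :=
    fun n => (ξ.measurable_acqTime n).comp measurable_fst
  have ht : Measurable fun z : (ℕ → Belief) × ℝ≥0 => (z.2 : ℝ≥0∞) :=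
    measurable_coe_nnreal_ennreal.comp measurable_snd
  have hS : ∀ n, MeasurableSet {z : (ℕ → Belief) × ℝ≥0 | ξ.acqTime n z.1 ≤ z.2 ∧
      (z.2 : ℝ≥0∞) < ξ.acqTime (n + 1) z.1} := fun n =>
    (measurableSet_le (hT n) ht).inter (measurableSet_lt ht (hT (n + 1)))
  have hS' : MeasurableSet {z : (ℕ → Belief) × ℝ≥0 | ∀ n, ξ.acqTime n z.1 ≤ z.2} := by
    rw [Set.ofPred_forall]
    exact MeasurableSet.iInter fun n => measurableSet_le (hT n) ht
  refine measurable_to_countable' fun k => ?_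
  have : (fun z : (ℕ → Belief) × ℝ≥0 => ξ.index z.1 z.2) ⁻¹' {k} =
      {z | ξ.acqTime k z.1 ≤ z.2 ∧ (z.2 : ℝ≥0∞) < ξ.acqTime (k + 1) z.1} ∪
      {z | k = 0 ∧ ∀ n, ξ.acqTime n z.1 ≤ z.2} := by
    ext z
    simp only [Set.mem_preimage, Set.mem_singleton_iff, Set.mem_union, Set.mem_ofPred_eq]
    constructor
    · rintro rfl
      rcases ξ.exists_index_or z.1 z.2 with ⟨n, h1, h2⟩ | h
      · rw [ξ.index_eq h1 h2]; exact Or.inl ⟨h1, h2⟩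
      · exact Or.inr ⟨ξ.index_eq_zero h, h⟩
    · rintro (⟨h1, h2⟩ | ⟨rfl, h⟩)
      · exact ξ.index_eq h1 h2
      · exact ξ.index_eq_zero h
  rw [this]
  refine (hS k).union ?_
  -- Index `0` also collects the times past an accumulation of acquisitions.
  by_cases hk : k = 0
  · simpa [hk] using hS'
  · simp [hk]

theorem measurable_belief : Measurable (fun z : (ℕ → Belief) × ℝ≥0 => ξ.belief z.1 z.2) := by
  have hT : ∀ n, Measurable fun z : (ℕ → Belief) × ℝ≥0 => (ξ.acqTime n z.1).toNNReal :=
    fun n => ((ξ.measurable_acqTime n).comp measurable_fst).ennreal_toNNReal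
  have hω : ∀ n, Measurable fun z : (ℕ → Belief) × ℝ≥0 => z.1 n :=
    fun n => (measurable_pi_apply n).comp measurable_fst
  have hd : ∀ n, Measurable fun z : (ℕ → Belief) × ℝ≥0 =>
      M.drift (z.1 n) (z.2 - (ξ.acqTime n z.1).toNNReal) := fun n =>
    M.continuous_drift.measurable.comp ((hω n).prodMk (measurable_snd.sub (hT n)))
  have h : Measurable (fun w : ℕ × ((ℕ → Belief) × ℝ≥0) =>
      M.drift (w.2.1 w.1) (w.2.2 - (ξ.acqTime w.1 w.2.1).toNNReal)) :=
    measurable_from_prod_countable_right hd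
  have h2 := h.comp (ξ.measurable_index.prodMk measurable_id)
  have e : (fun z : (ℕ → Belief) × ℝ≥0 => ξ.belief z.1 z.2) = fun z =>
      M.drift (z.1 (ξ.index z.1 z.2)) (z.2 - (ξ.acqTime (ξ.index z.1 z.2) z.1).toNNReal) :=
    funext fun z => ξ.belief_eq_index z.1 z.2
  rw [e]
  exact h2

/-- The discounted flow utility at time `t`. -/
def flow (ω : ℕ → Belief) (t : ℝ) : ℝ :=
  Real.exp (-M.r * t) * M.u (ξ.belief ω t.toNNReal : ℝ)

/-- Discounted flow utility along a realization. -/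
def pathUtility (ω : ℕ → Belief) : ℝ := ∫ t in Set.Ioi (0 : ℝ), ξ.flow ω t

/-- Discounted information costs along a realization. -/
def pathCost (ω : ℕ → Belief) : ℝ≥0∞ := ∑' n : ℕ, M.discount (ξ.acqTime (n + 1) ω) *
  (M.cost (ξ.exper n (hist ω n)) + ENNReal.ofReal M.fixedCost)

theorem utility_eq (p : Belief) : ξ.utility p = ∫ ω, ξ.pathUtility ω ∂(ξ.law p) := rfl

theorem totalCost_eq (p : Belief) : ξ.totalCost p = ∫⁻ ω, ξ.pathCost ω ∂(ξ.law p) := rfl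

theorem measurable_flow : Measurable (Function.uncurry ξ.flow) := by
  have h0 := ξ.measurable_belief
  have h : Measurable (fun z : (ℕ → Belief) × ℝ => ξ.belief z.1 z.2.toNNReal) := by
    generalize ξ.belief = f at h0
    exact h0.comp (measurable_fst.prodMk measurable_snd.real_toNNReal)
  have h2 : Measurable (fun z : (ℕ → Belief) × ℝ => Real.exp (-M.r * z.2)) := by fun_prop
  exact h2.mul (M.continuous_u.measurable.comp h)

theorem abs_flow_le (ω : ℕ → Belief) (t : ℝ) :
    |ξ.flow ω t| ≤ M.utilityBound * Real.exp (-M.r * t) := by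
  rw [flow, abs_mul, abs_of_pos (Real.exp_pos _), mul_comm]
  exact mul_le_mul_of_nonneg_right (M.abs_u_le _) (Real.exp_pos _).le

theorem measurable_flow_apply (ω : ℕ → Belief) : Measurable (ξ.flow ω) := by
  have h := ξ.measurable_flow
  have h2 := h.comp (measurable_prodMk_left (x := ω))
  exact h2

theorem integrableOn_flow (ω : ℕ → Belief) : IntegrableOn (ξ.flow ω) (Set.Ioi 0) := by
  have h1 := ξ.abs_flow_le ω
  have h2 := (ξ.measurable_flow_apply ω).aestronglyMeasurable
    (μ := volume.restrict (Set.Ioi (0 : ℝ)))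
  have h3 := M.integrableOn_exp.const_mul M.utilityBound
  generalize ξ.flow ω = f at h1 h2
  exact h3.mono' h2 (ae_of_all _ h1)

theorem abs_pathUtility_le (ω : ℕ → Belief) : |ξ.pathUtility ω| ≤ M.utilityBound / M.r := by
  have := norm_integral_le_of_norm_le (f := ξ.flow ω) (μ := volume.restrict (Set.Ioi (0 : ℝ)))
    (M.integrableOn_exp.const_mul M.utilityBound)
    (ae_of_all _ (ξ.abs_flow_le ω))
  rw [integral_const_mul, M.integral_exp] at this
  simpa [pathUtility, div_eq_mul_inv] using this

theorem measurable_pathUtility : Measurable ξ.pathUtility :=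
  (ξ.measurable_flow.stronglyMeasurable.integral_prod_right
    (ν := volume.restrict (Set.Ioi (0 : ℝ)))).measurable

theorem integrable_pathUtility (μ : Measure (ℕ → Belief)) [IsFiniteMeasure μ] :
    Integrable ξ.pathUtility μ :=
  (integrable_const (M.utilityBound / M.r)).mono' ξ.measurable_pathUtility.aestronglyMeasurable
    (ae_of_all _ ξ.abs_pathUtility_le)

theorem abs_utility_le (p : Belief) : |ξ.utility p| ≤ M.utilityBound / M.r := by
  have := norm_integral_le_of_norm_le_const (f := ξ.pathUtility) (μ := ξ.law p)
    (ae_of_all _ ξ.abs_pathUtility_le)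
  simpa [utility_eq] using this

/-- The policy that never acquires information. -/
def never (M : Model) : Policy M where
  wait _ _ := ⊤
  measurable_wait _ := measurable_const
  exper _ := Kernel.const _ (Measure.dirac ⟨0, by simp⟩)
  markov _ := inferInstance
  bayes _ _ h := absurd rfl h

theorem totalCost_never (p : Belief) : (never M).totalCost p = 0 := by
  have : ∀ ω, (never M).pathCost ω = 0 := by
    intro ω
    refine ENNReal.tsum_eq_zero.2 fun n => ?_
    have : (never M).acqTime (n + 1) ω = ⊤ := by
      rw [acqTime_succ]; simp [never]
    rw [this, M.discount_top, zero_mul]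
  simp [totalCost_eq, this]

theorem payoff_eq_of_ne_top {p : Belief} (h : ξ.totalCost p ≠ ⊤) :
    ξ.payoff p = ((ξ.utility p - (ξ.totalCost p).toReal : ℝ) : EReal) := by
  rw [payoff, EReal.coe_sub, EReal.coe_ennreal_toReal h]

theorem payoff_eq_of_eq_top {p : Belief} (h : ξ.totalCost p = ⊤) : ξ.payoff p = ⊥ := by
  rw [payoff, h]; simp

theorem payoff_le (p : Belief) : ξ.payoff p ≤ ((M.utilityBound / M.r : ℝ) : EReal) := by
  by_cases h : ξ.totalCost p = ⊤
  · rw [ξ.payoff_eq_of_eq_top h]; exact bot_le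
  · rw [ξ.payoff_eq_of_ne_top h, EReal.coe_le_coe_iff]
    linarith [(abs_le.1 (ξ.abs_utility_le p)).2, (ξ.totalCost p).toReal_nonneg]

end Policy

/-! ### The value function as a finite supremum. -/

namespace Model

variable (M : Model)

theorem le_iSup_payoff (p : Belief) :
    ((-(M.utilityBound / M.r) : ℝ) : EReal) ≤ ⨆ ξ : Policy M, ξ.payoff p := by
  refine le_trans ?_ (le_iSup _ (Policy.never M))
  rw [Policy.payoff_eq_of_ne_top _ (by simp [Policy.totalCost_never]), EReal.coe_le_coe_iff,
    Policy.totalCost_never]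
  simpa using (abs_le.1 ((Policy.never M).abs_utility_le p)).1

theorem iSup_payoff_le (p : Belief) :
    ⨆ ξ : Policy M, ξ.payoff p ≤ ((M.utilityBound / M.r : ℝ) : EReal) :=
  iSup_le fun ξ => ξ.payoff_le p

/-- Bounded utility bounds all payoffs above, and never acquiring bounds the supremum below, so
`toReal` loses nothing. -/
theorem coe_value (p : Belief) : (M.value p : EReal) = ⨆ ξ : Policy M, ξ.payoff p := by
  refine EReal.coe_toReal (ne_of_lt ((M.iSup_payoff_le p).trans_lt (EReal.coe_lt_top _)))
    (ne_of_gt ((EReal.bot_lt_coe _).trans_le (M.le_iSup_payoff p)))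

theorem abs_value_le (p : Belief) : |M.value p| ≤ M.utilityBound / M.r := by
  rw [abs_le]
  constructor
  · have := M.le_iSup_payoff p
    rwa [← M.coe_value, EReal.coe_le_coe_iff] at this
  · have := M.iSup_payoff_le p
    rwa [← M.coe_value, EReal.coe_le_coe_iff] at this

theorem le_value (ξ : Policy M) {p : Belief} (h : ξ.totalCost p ≠ ⊤) :
    ξ.utility p - (ξ.totalCost p).toReal ≤ M.value p := by
  have := le_iSup (fun ξ : Policy M => ξ.payoff p) ξ
  rwa [← M.coe_value, ξ.payoff_eq_of_ne_top h, EReal.coe_le_coe_iff] at this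

theorem exists_policy_near_value (p : Belief) {η : ℝ} (hη : 0 < η) : ∃ ξ : Policy M,
    ξ.totalCost p ≠ ⊤ ∧ M.value p - η < ξ.utility p - (ξ.totalCost p).toReal := by
  have h : ((M.value p - η : ℝ) : EReal) < ⨆ ξ : Policy M, ξ.payoff p := by
    rw [← M.coe_value, EReal.coe_lt_coe_iff]; linarith
  obtain ⟨ξ, hξ⟩ := lt_iSup_iff.1 h
  have ht : ξ.totalCost p ≠ ⊤ := by
    intro ht
    rw [ξ.payoff_eq_of_eq_top ht] at hξ
    exact not_lt_bot hξ
  refine ⟨ξ, ht, ?_⟩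
  rwa [ξ.payoff_eq_of_ne_top ht, EReal.coe_lt_coe_iff] at hξ

end Model

/-! ### Policies with a modified start, and their laws. -/

theorem integrable_coe (F : Measure Belief) [IsFiniteMeasure F] :
    Integrable (fun q : Belief => (q : ℝ)) F := by
  refine (integrable_const (1 : ℝ)).mono' continuous_subtype_val.measurable.aestronglyMeasurable
    (ae_of_all _ fun q => ?_)
  rw [Real.norm_eq_abs, abs_of_nonneg q.2.1]; exact q.2.2

namespace History

/-- The initial belief of a history. -/
def first {n : ℕ} (h : History n) : Belief := h ⟨0, Finset.mem_Iic.2 (Nat.zero_le _)⟩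

/-- The first posterior of a history. -/
def second {n : ℕ} (h : History (n + 1)) : Belief :=
  h ⟨1, Finset.mem_Iic.2 (Nat.succ_le_succ (Nat.zero_le _))⟩

/-- The history with the initial belief replaced by `x`. -/
def replaceFirst (x : Belief) {n : ℕ} (h : History n) : History n :=
  fun i => if (i : ℕ) = 0 then x else h i

theorem measurable_apply {n : ℕ} (i : Finset.Iic n) : Measurable (fun h : History n => h i) :=
  measurable_pi_apply (X := fun _ : Finset.Iic n => Belief) i

theorem measurable_replaceFirst (x : Belief) {n : ℕ} :
    Measurable (replaceFirst x (n := n)) := by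
  refine measurable_pi_lambda _ fun i => ?_
  unfold replaceFirst
  split_ifs
  · exact measurable_const
  · exact measurable_apply i

theorem last_replaceFirst (x : Belief) {n : ℕ} (h : History (n + 1)) :
    (replaceFirst x h).last = h.last := by
  simp [last, replaceFirst]

/-- Histories that start at `y` and whose first posterior is not `e`. -/
def passing (y e : Belief) (n : ℕ) : Set (History (n + 1)) := {h | h.first = y ∧ h.second ≠ e}

theorem measurableSet_passing (y e : Belief) (n : ℕ) : MeasurableSet (passing y e n) :=
  (measurable_apply _ (measurableSet_singleton y)).inter
    (measurable_apply _ (measurableSet_singleton e).compl)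

end History

namespace Policy

variable {M : Model} (ξ : Policy M)

open Classical in
/-- The policy that, from `y`, waits for `τ`, acquires `F`, never acquires information again if the
posterior is `e`, and otherwise continues as `ξ` would if the initial belief had been `x`. -/
def redirect (x y e : Belief) (τ : ℝ≥0∞) (F : Measure Belief) [IsProbabilityMeasure F]
    (hF : τ ≠ ⊤ → ∫ q, (q : ℝ) ∂F = (M.drift y τ.toNNReal : ℝ)) : Policy M where
  wait := fun n => match n with
    | 0 => fun h => if h.first = y then τ else ⊤
    | n + 1 => fun h => if h ∈ History.passing y e n then
        ξ.wait (n + 1) (h.replaceFirst x) else ⊤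
  measurable_wait := fun n => match n with
    | 0 => Measurable.ite (History.measurable_apply _ (measurableSet_singleton y))
        measurable_const measurable_const
    | n + 1 => Measurable.ite (History.measurableSet_passing y e n)
        ((ξ.measurable_wait (n + 1)).comp (History.measurable_replaceFirst x)) measurable_const
  exper := fun n => match n with
    | 0 => Kernel.const _ F
    | n + 1 => Kernel.piecewise (History.measurableSet_passing y e n)
        (Kernel.comap (ξ.exper (n + 1)) (History.replaceFirst x)
          (History.measurable_replaceFirst x))
        (Kernel.const _ (Measure.dirac e))
  markov := fun n => match n with
    | 0 => inferInstanceAs (IsMarkovKernel (Kernel.const _ F))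
    | n + 1 => by
      have := Kernel.IsMarkovKernel.comap (ξ.exper (n + 1))
        (History.measurable_replaceFirst x (n := n + 1))
      exact Kernel.IsMarkovKernel.piecewise
  bayes := fun n => match n with
    | 0 => fun h hh => by
      dsimp only at hh ⊢
      split_ifs at hh ⊢ with h1
      · have : h.last = y := h1
        rw [this]; exact hF hh
      · exact absurd rfl hh
    | n + 1 => fun h hh => by
      dsimp only at hh ⊢
      by_cases h1 : h ∈ History.passing y e n
      · simp only [h1, if_true] at hh ⊢
        have := ξ.bayes (n + 1) _ hh
        rw [History.last_replaceFirst] at this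
        rw [← this, Kernel.piecewise_apply, if_pos h1, Kernel.comap_apply]
      · simp [h1] at hh

/-- The sequence of beliefs `y, e, e, ...`. -/
def constAfter (y e : Belief) : ℕ → Belief := fun n => if n = 0 then y else e

variable {ξ}

section Redirect

variable {x y e : Belief} {τ : ℝ≥0∞} {F : Measure Belief} [IsProbabilityMeasure F]
  {hF : τ ≠ ⊤ → ∫ q, (q : ℝ) ∂F = (M.drift y τ.toNNReal : ℝ)}

theorem hist_update_succ_mem (ω : ℕ → Belief) (n : ℕ) (h1 : ω 1 ≠ e) :
    hist (Function.update ω 0 y) (n + 1) ∈ History.passing y e n :=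
  ⟨by simp [History.first, hist], by simpa [History.second, hist] using h1⟩

theorem hist_constAfter_notMem (n : ℕ) :
    hist (constAfter y e) (n + 1) ∉ History.passing y e n := fun h =>
  h.2 (by simp [History.second, hist, constAfter])

theorem hist_update (ω : ℕ → Belief) (n : ℕ) :
    hist (Function.update ω 0 y) n = (hist ω n).replaceFirst y := by
  funext i
  unfold History.replaceFirst hist
  split_ifs with h
  · rw [h]; simp
  · rw [Function.update_of_ne h]

theorem replaceFirst_hist_update (ω : ℕ → Belief) (n : ℕ) (h0 : ω 0 = x) :
    (hist (Function.update ω 0 y) n).replaceFirst x = hist ω n := by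
  funext i
  unfold History.replaceFirst hist
  split_ifs with h
  · rw [h, h0]
  · rw [Function.update_of_ne h]

theorem redirect_exper_zero (h : History 0) : (ξ.redirect x y e τ F hF).exper 0 h = F := rfl

theorem redirect_exper_succ (ω : ℕ → Belief) (n : ℕ) (h0 : ω 0 = x) (h1 : ω 1 ≠ e) :
    (ξ.redirect x y e τ F hF).exper (n + 1) (hist (Function.update ω 0 y) (n + 1)) =
      ξ.exper (n + 1) (hist ω (n + 1)) := by
  classical
  simp only [redirect]
  rw [Kernel.piecewise_apply, if_pos (hist_update_succ_mem ω n h1), Kernel.comap_apply,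
    replaceFirst_hist_update ω _ h0]

theorem redirect_exper_constAfter (n : ℕ) :
    (ξ.redirect x y e τ F hF).exper (n + 1) (hist (constAfter y e) (n + 1)) =
      Measure.dirac e := by
  classical
  simp only [redirect]
  rw [Kernel.piecewise_apply, if_neg (hist_constAfter_notMem n), Kernel.const_apply]

theorem redirect_wait_zero (h : History 0) (hh : h.first = y) :
    (ξ.redirect x y e τ F hF).wait 0 h = τ := if_pos hh

theorem redirect_wait_succ (ω : ℕ → Belief) (n : ℕ) (h0 : ω 0 = x) (h1 : ω 1 ≠ e) :
    (ξ.redirect x y e τ F hF).wait (n + 1) (hist (Function.update ω 0 y) (n + 1)) =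
      ξ.wait (n + 1) (hist ω (n + 1)) := by
  simp only [redirect]
  rw [if_pos (hist_update_succ_mem ω n h1), replaceFirst_hist_update ω _ h0]

theorem redirect_wait_constAfter (n : ℕ) :
    (ξ.redirect x y e τ F hF).wait (n + 1) (hist (constAfter y e) (n + 1)) = ⊤ :=
  if_neg (hist_constAfter_notMem n)

theorem hist_zero_eq (ω : ℕ → Belief) : hist ω 0 = fun _ => ω 0 := by
  funext i
  have : (i : ℕ) = 0 := Nat.le_zero.1 (Finset.mem_Iic.1 i.2)
  simp [hist, this]

theorem law_first_posterior (p : Belief) {B : Set Belief} (hB : MeasurableSet B) :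
    (ξ.law p) {ω | ω 1 ∈ B} = ξ.exper 0 (fun _ => p) B := by
  have h := (ξ.isLaw_law p).step 0 Set.univ B MeasurableSet.univ hB
  have h2 : ∫⁻ ω, ξ.exper 0 (hist ω 0) B ∂(ξ.law p) =
      ∫⁻ ω, ξ.exper 0 (fun _ => p) B ∂(ξ.law p) := by
    refine lintegral_congr_ae ?_
    filter_upwards [ξ.law_start p] with ω hω
    rw [hist_zero_eq, hω]
  simpa [h2] using h

theorem law_first_posterior_ne (p : Belief) (he : ξ.exper 0 (fun _ => p) {e} = 0) :
    ∀ᵐ ω ∂(ξ.law p), ω 1 ≠ e := by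
  rw [ae_iff]
  have := law_first_posterior (ξ := ξ) p (measurableSet_singleton e)
  rw [he] at this
  simpa using this

theorem measurable_update_zero (y : Belief) :
    Measurable (fun ω : ℕ → Belief => Function.update ω 0 y) :=
  measurable_update_left

/-- As `e` is not an atom of the first experiment from `x`, the posterior itself reveals whether the
original branch or the extra one was drawn. The law is therefore a mixture of the old law, with its
start replaced, and one deterministic path. -/
theorem redirect_law {a b : ℝ≥0∞} (hab : a + b = 1)
    (hFab : F = a • ξ.exper 0 (fun _ => x) + b • Measure.dirac e)
    (he : ξ.exper 0 (fun _ => x) {e} = 0) :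
    (ξ.redirect x y e τ F hF).law y =
      a • (ξ.law x).map (fun ω => Function.update ω 0 y) + b • Measure.dirac (constAfter y e) := by
  symm
  apply IsLaw.eq_law
  have hΦ := measurable_update_zero y
  have hP : IsProbabilityMeasure ((ξ.law x).map (fun ω => Function.update ω 0 y)) :=
    Measure.isProbabilityMeasure_map hΦ.aemeasurable
  refine ⟨⟨?_⟩, ?_, ?_⟩
  · simp [hab]
  · rw [ae_add_measure_iff]
    constructor
    · refine Measure.ae_smul_measure ?_ a
      have h0 : MeasurableSet {ω : ℕ → Belief | ω 0 = y} :=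
        measurable_pi_apply (X := fun _ : ℕ => Belief) 0 (measurableSet_singleton y)
      rw [ae_map_iff hΦ.aemeasurable h0]
      exact ae_of_all _ fun ω => by simp
    · refine Measure.ae_smul_measure ?_ b
      rw [ae_dirac_eq]; rfl
  · intro n A B hA hB
    have hm := measurable_hist n
    have hS1 : MeasurableSet {ω : ℕ → Belief | hist ω n ∈ A} := hm hA
    have hS : MeasurableSet {ω : ℕ → Belief | hist ω n ∈ A ∧ ω (n + 1) ∈ B} :=
      hS1.inter (measurable_pi_apply _ hB)
    have hf : Measurable (fun ω : ℕ → Belief =>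
        (ξ.redirect x y e τ F hF).exper n (hist ω n) B) :=
      (Kernel.measurable_coe _ hB).comp hm
    classical
    rw [Measure.restrict_add, lintegral_add_measure, Measure.restrict_smul, Measure.restrict_smul,
      lintegral_smul_measure, lintegral_smul_measure, setLIntegral_map hS1 hf hΦ,
      setLIntegral_dirac, Measure.add_apply, Measure.smul_apply, Measure.smul_apply,
      Measure.map_apply hΦ hS, Measure.dirac_apply' _ hS]
    simp only [smul_eq_mul]
    have hae : ∀ᵐ ω ∂(ξ.law x), ω 0 = x ∧ ω 1 ≠ e :=
      (ξ.law_start x).and (law_first_posterior_ne x he)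
    -- At the first transition the two branches mix to `F`; afterwards each follows its own kernel.
    rcases n with _ | n
    · simp only [redirect_exper_zero, lintegral_const, Measure.restrict_apply MeasurableSet.univ,
        Set.univ_inter]
      have h1 : ∀ ω : ℕ → Belief, hist (Function.update ω 0 y) 0 = fun _ => y := fun ω => by
        rw [hist_zero_eq]; simp
      have h2 : hist (constAfter y e) 0 = fun _ => y := by rw [hist_zero_eq]; simp [constAfter]
      by_cases hy : (fun _ => y : History 0) ∈ A
      · have h3 := law_first_posterior (ξ := ξ) x hB
        have h4 : (constAfter y e 1 ∈ B) = (e ∈ B) := by simp [constAfter]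
        simp only [Set.preimage_ofPred_eq, h1, h2, hy, true_and, if_true, zero_add, Set.indicator,
          Set.mem_ofPred_eq, Set.ofPred_true, measure_univ, mul_one, h4]
        have h5 : {ω : ℕ → Belief | Function.update ω 0 y 1 ∈ B} = {ω | ω 1 ∈ B} := by
          ext ω; simp
        rw [h5, h3, ← add_mul, hab, one_mul]
        conv_rhs => rw [hFab]
        simp [Measure.dirac_apply' _ hB, Set.indicator]
      · simp [h1, h2, hy, Set.indicator]
    · have e1 : (fun ω : ℕ → Belief => Function.update ω 0 y) ⁻¹'
          {ω | hist ω (n + 1) ∈ A ∧ ω (n + 1 + 1) ∈ B} =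
          {ω | hist ω (n + 1) ∈ (fun ω : History (n + 1) => ω.replaceFirst y) ⁻¹' A ∧
            ω (n + 1 + 1) ∈ B} := by
        ext ω
        simp [hist_update]
      have e2 : (fun ω : ℕ → Belief => Function.update ω 0 y) ⁻¹' {ω | hist ω (n + 1) ∈ A} =
          {ω | hist ω (n + 1) ∈ (fun ω : History (n + 1) => ω.replaceFirst y) ⁻¹' A} := by
        ext ω
        simp [hist_update]
      rw [e1, e2, (ξ.isLaw_law x).step (n + 1) _ B
        (History.measurable_replaceFirst y hA) hB]
      congr 2
      · refine lintegral_congr_ae (ae_restrict_of_ae ?_)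
        filter_upwards [hae] with ω hω
        exact (congrArg (fun μ : Measure Belief => μ B)
          (redirect_exper_succ ω n hω.1 hω.2)).symm
      · rw [redirect_exper_constAfter, Measure.dirac_apply' _ hB]
        have : constAfter y e (n + 1 + 1) = e := by simp [constAfter]
        by_cases h : hist (constAfter y e) (n + 1) ∈ A
        · by_cases h' : e ∈ B
          · simp [Set.indicator, h, h', this]
          · simp [Set.indicator, h', this]
        · simp [Set.indicator, h]

end Redirect

end Policy

/-! ### Payoffs when the first experiment is mixed with a further posterior. -/

namespace Policy

variable {M : Model}

/-- The belief paths can differ only where they drift from the initial belief: before the first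
acquisition or, by convention, after an accumulation. The flows differ by at most `η * exp (-r t)`,
which integrates to `η / r`. -/
theorem abs_pathUtility_sub_le {ξ₁ ξ₂ : Policy M} {ω₁ ω₂ : ℕ → Belief}
    (hacq : ∀ n, ξ₁.acqTime n ω₁ = ξ₂.acqTime n ω₂) (hω : ∀ n, ω₁ (n + 1) = ω₂ (n + 1)) {η : ℝ}
    (hη : ∀ t, |M.u (M.drift (ω₁ 0) t) - M.u (M.drift (ω₂ 0) t)| ≤ η) :
    |ξ₁.pathUtility ω₁ - ξ₂.pathUtility ω₂| ≤ η / M.r := by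
  have hη0 : 0 ≤ η := (abs_nonneg _).trans (hη 0)
  have hb : ∀ t : ℝ≥0, |M.u (ξ₁.belief ω₁ t) - M.u (ξ₂.belief ω₂ t)| ≤ η := by
    intro t
    have key : ∀ n s, |M.u (M.drift (ω₁ n) s) - M.u (M.drift (ω₂ n) s)| ≤ η := by
      intro n s
      rcases n with _ | n
      · exact hη s
      · rw [hω n]; simpa using hη0
    rcases ξ₁.exists_index_or ω₁ t with ⟨n, h1, h2⟩ | h
    · rw [ξ₁.belief_eq h1 h2, hacq n, ξ₂.belief_eq (hacq n ▸ h1) (hacq (n + 1) ▸ h2)]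
      exact key n _
    · rw [ξ₁.belief_eq_of_forall_le h, ξ₂.belief_eq_of_forall_le fun n => hacq n ▸ h n]
      exact key 0 _
  have hf : ∀ t : ℝ, |ξ₁.flow ω₁ t - ξ₂.flow ω₂ t| ≤ η * Real.exp (-M.r * t) := by
    intro t
    rw [flow, flow, ← mul_sub, abs_mul, abs_of_pos (Real.exp_pos _), mul_comm]
    exact mul_le_mul_of_nonneg_right (hb _) (Real.exp_pos _).le
  have h1 := ξ₁.integrableOn_flow ω₁
  have h2 := ξ₂.integrableOn_flow ω₂
  unfold pathUtility
  rw [← integral_sub h1 h2]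
  have := norm_integral_le_of_norm_le (f := fun t => ξ₁.flow ω₁ t - ξ₂.flow ω₂ t)
    (μ := volume.restrict (Set.Ioi (0 : ℝ))) (M.integrableOn_exp.const_mul η) (ae_of_all _ hf)
  rw [integral_const_mul, M.integral_exp] at this
  simpa [div_eq_mul_inv] using this

section Redirect

variable {ξ : Policy M} {x y e : Belief} {τ : ℝ≥0∞} {F : Measure Belief} [IsProbabilityMeasure F]
  {hF : τ ≠ ⊤ → ∫ q, (q : ℝ) ∂F = (M.drift y τ.toNNReal : ℝ)}

/-- Summands on both sides cover equal, delayed and advanced first acquisitions at once, without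
subtraction in `[0, ∞]`. -/
theorem redirect_acqTime_add {s s' : ℝ≥0∞} (h : τ + s = ξ.wait 0 (fun _ => x) + s')
    {ω : ℕ → Belief} (h0 : ω 0 = x) (h1 : ω 1 ≠ e) (n : ℕ) :
    (ξ.redirect x y e τ F hF).acqTime (n + 1) (Function.update ω 0 y) + s =
      ξ.acqTime (n + 1) ω + s' := by
  induction n with
  | zero =>
    rw [acqTime_succ, acqTime_succ, redirect_wait_zero _ (by simp [History.first, hist]),
      hist_zero_eq ω, h0]
    simpa [acqTime] using h
  | succ n ih =>
    rw [acqTime_succ, redirect_wait_succ ω n h0 h1, add_right_comm, ih, acqTime_succ ξ (n + 1),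
      add_right_comm]

theorem redirect_acqTime (h : τ = ξ.wait 0 (fun _ => x))
    {ω : ℕ → Belief} (h0 : ω 0 = x) (h1 : ω 1 ≠ e) (n : ℕ) :
    (ξ.redirect x y e τ F hF).acqTime n (Function.update ω 0 y) = ξ.acqTime n ω := by
  rcases n with _ | n
  · rfl
  · simpa using redirect_acqTime_add (s := 0) (s' := 0) (hF := hF) (by simpa using h) h0 h1 n

theorem redirect_utility {a b : ℝ≥0∞} (hab : a + b = 1)
    (hFab : F = a • ξ.exper 0 (fun _ => x) + b • Measure.dirac e)
    (he : ξ.exper 0 (fun _ => x) {e} = 0) :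
    (ξ.redirect x y e τ F hF).utility y =
      a.toReal * ∫ ω, (ξ.redirect x y e τ F hF).pathUtility (Function.update ω 0 y) ∂(ξ.law x) +
      b.toReal * (ξ.redirect x y e τ F hF).pathUtility (constAfter y e) := by
  have ha : a ≠ ⊤ := ne_top_of_le_ne_top ENNReal.one_ne_top (hab ▸ le_self_add)
  have hb : b ≠ ⊤ := ne_top_of_le_ne_top ENNReal.one_ne_top (hab ▸ le_add_self)
  have hΦ := measurable_update_zero y
  have : IsProbabilityMeasure ((ξ.law x).map (fun ω => Function.update ω 0 y)) :=
    Measure.isProbabilityMeasure_map hΦ.aemeasurable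
  have hm := (ξ.redirect x y e τ F hF).measurable_pathUtility
  have hi := fun μ : Measure (ℕ → Belief) => fun [IsFiniteMeasure μ] =>
    (ξ.redirect x y e τ F hF).integrable_pathUtility μ
  rw [utility_eq, redirect_law hab hFab he]
  generalize (ξ.redirect x y e τ F hF).pathUtility = J at hm hi
  rw [integral_add_measure ((hi _).smul_measure ha) ((hi _).smul_measure hb),
    integral_smul_measure, integral_smul_measure, integral_dirac,
    integral_map hΦ.aemeasurable hm.aestronglyMeasurable]
  rfl

/-- The inequality suffices for bounding values from below, and `lintegral_map_le` gives it without
measurability of `pathCost`. -/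
theorem redirect_totalCost_le {a b : ℝ≥0∞} (hab : a + b = 1)
    (hFab : F = a • ξ.exper 0 (fun _ => x) + b • Measure.dirac e)
    (he : ξ.exper 0 (fun _ => x) {e} = 0) :
    (ξ.redirect x y e τ F hF).totalCost y ≤
      a * ∫⁻ ω, (ξ.redirect x y e τ F hF).pathCost (Function.update ω 0 y) ∂(ξ.law x) +
      b * (ξ.redirect x y e τ F hF).pathCost (constAfter y e) := by
  rw [totalCost_eq, redirect_law hab hFab he]
  generalize (ξ.redirect x y e τ F hF).pathCost = K
  rw [lintegral_add_measure, lintegral_smul_measure, lintegral_smul_measure, lintegral_dirac]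
  exact add_le_add (mul_le_mul_right (lintegral_map_le K (fun ω => Function.update ω 0 y)) a) le_rfl

theorem pathCost_eq (ξ : Policy M) (ω : ℕ → Belief) : ξ.pathCost ω =
    M.discount (ξ.acqTime 1 ω) *
      (M.cost (ξ.exper 0 (hist ω 0)) + ENNReal.ofReal M.fixedCost) +
    ∑' n : ℕ, M.discount (ξ.acqTime (n + 2) ω) *
      (M.cost (ξ.exper (n + 1) (hist ω (n + 1))) + ENNReal.ofReal M.fixedCost) :=
  tsum_eq_zero_add' ENNReal.summable

theorem redirect_pathCost_constAfter :
    (ξ.redirect x y e τ F hF).pathCost (constAfter y e) =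
      M.discount τ * (M.cost F + ENNReal.ofReal M.fixedCost) := by
  have h0 : (ξ.redirect x y e τ F hF).acqTime 1 (constAfter y e) = τ := by
    rw [acqTime_succ, redirect_wait_zero _ (by simp [History.first, hist, constAfter])]
    simp [acqTime]
  have h1 : ∀ n, (ξ.redirect x y e τ F hF).acqTime (n + 2) (constAfter y e) = ⊤ := by
    intro n
    rw [acqTime_succ, redirect_wait_constAfter]
    simp
  rw [pathCost_eq, h0, redirect_exper_zero]
  simp [h1, M.discount_top]

/-- Serves to bound the cost on the branch to `e`, where the first acquisition is the only one. -/
theorem le_totalCost (ξ : Policy M) (x : Belief) :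
    M.discount (ξ.wait 0 fun _ => x) *
      (M.cost (ξ.exper 0 fun _ => x) + ENNReal.ofReal M.fixedCost) ≤ ξ.totalCost x := by
  have h : ∫⁻ _, M.discount (ξ.wait 0 fun _ => x) *
      (M.cost (ξ.exper 0 fun _ => x) + ENNReal.ofReal M.fixedCost) ∂(ξ.law x) ≤
      ξ.totalCost x := by
    rw [totalCost_eq]
    refine lintegral_mono_ae ?_
    filter_upwards [ξ.law_start x] with ω h0
    refine le_trans (le_of_eq ?_) (ENNReal.le_tsum 0)
    rw [acqTime_succ, hist_zero_eq, h0]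
    simp [acqTime]
  simpa using h

/-- If a belief `y` and an experiment from it are obtained by mixing the first experiment acquired
from `x` with a further posterior `e`, then the value at `y` is almost as large as the payoff of
the policy from `x`. -/
theorem le_value_of_mixture (ξ : Policy M) {x y e : Belief} {ε η₁ η₂ : ℝ} (hε0 : 0 ≤ ε)
    (hε1 : ε ≤ 1) (hη₁ : 0 ≤ η₁) (hx : ξ.totalCost x ≠ ⊤)
    (hmean : ξ.wait 0 (fun _ => x) ≠ ⊤ →
      (1 - ε) * (M.drift x (ξ.wait 0 fun _ => x).toNNReal : ℝ) + ε * e =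
        M.drift y (ξ.wait 0 fun _ => x).toNNReal)
    (he : ξ.exper 0 (fun _ => x) {e} = 0)
    (hu : ∀ t, |M.u (M.drift y t) - M.u (M.drift x t)| ≤ η₁)
    (hc : ξ.wait 0 (fun _ => x) ≠ ⊤ →
      M.c (M.drift x (ξ.wait 0 fun _ => x).toNNReal) + ENNReal.ofReal ε * M.c e ≤
        M.c (M.drift y (ξ.wait 0 fun _ => x).toNNReal) + ENNReal.ofReal η₂)
    (hη₂ : 0 ≤ η₂) :
    ξ.utility x - (ξ.totalCost x).toReal - (η₁ / M.r + 2 * ε * (M.utilityBound / M.r) + η₂) ≤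
      M.value y := by
  set τ := ξ.wait 0 (fun _ => x) with hτ
  set F₀ := ξ.exper 0 (fun _ => x) with hF₀
  set a := ENNReal.ofReal (1 - ε)
  set b := ENNReal.ofReal ε
  have hab : a + b = 1 := by
    rw [← ENNReal.ofReal_add (by linarith) hε0]; simp
  have ha1 : a ≤ 1 := hab ▸ le_self_add
  have ha : a ≠ ⊤ := ENNReal.ofReal_ne_top
  have hb : b ≠ ⊤ := ENNReal.ofReal_ne_top
  set F : Measure Belief := a • F₀ + b • Measure.dirac e with hFdef
  have hFp : IsProbabilityMeasure F := ⟨by simp [hFdef, hab]⟩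
  have hF : τ ≠ ⊤ → ∫ q, (q : ℝ) ∂F = (M.drift y τ.toNNReal : ℝ) := by
    intro h
    rw [hFdef, integral_add_measure ((integrable_coe _).smul_measure ha)
      ((integrable_coe _).smul_measure hb), integral_smul_measure, integral_smul_measure,
      integral_dirac, ξ.bayes 0 _ h, ENNReal.toReal_ofReal (by linarith),
      ENNReal.toReal_ofReal hε0, ← hmean h]
    rfl
  have hcostF : τ ≠ ⊤ → M.cost F ≤ M.cost F₀ + ENNReal.ofReal η₂ := by
    intro h
    have h2 := ξ.bayes 0 (fun _ => x) h
    unfold Model.cost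
    rw [hF h, h2, tsub_le_iff_right]
    rw [hFdef, lintegral_add_measure, lintegral_smul_measure, lintegral_smul_measure,
      lintegral_dirac]
    -- The weight `a ≤ 1` is dropped. As subtraction is truncated, `le_tsub_add` reinserts the value
    -- of `c` at the old mean without any finiteness.
    calc a * ∫⁻ q, M.c q ∂F₀ + b * M.c e ≤ ∫⁻ q, M.c q ∂F₀ + b * M.c e := by
          gcongr; exact mul_le_of_le_one_left' ha1
      _ ≤ (∫⁻ q, M.c q ∂F₀ - M.c (M.drift x τ.toNNReal) + M.c (M.drift x τ.toNNReal)) +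
          b * M.c e := by
          gcongr; exact le_tsub_add
      _ = (∫⁻ q, M.c q ∂F₀ - M.c (M.drift x τ.toNNReal)) +
          (M.c (M.drift x τ.toNNReal) + b * M.c e) := by ring
      _ ≤ (∫⁻ q, M.c q ∂F₀ - M.c (M.drift x τ.toNNReal)) +
          (M.c (M.drift y τ.toNNReal) + ENNReal.ofReal η₂) := by exact add_le_add le_rfl (hc h)
      _ = _ := by simp only [History.last]; ring
  have hdc : M.discount τ * (M.cost F + ENNReal.ofReal M.fixedCost) ≤
      M.discount τ * (M.cost F₀ + ENNReal.ofReal M.fixedCost) + ENNReal.ofReal η₂ := by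
    by_cases h : τ = ⊤
    · simp [h, M.discount_top]
    · calc M.discount τ * (M.cost F + ENNReal.ofReal M.fixedCost)
          ≤ M.discount τ * ((M.cost F₀ + ENNReal.ofReal η₂) + ENNReal.ofReal M.fixedCost) := by
            gcongr; exact hcostF h
        _ = M.discount τ * (M.cost F₀ + ENNReal.ofReal M.fixedCost) +
            M.discount τ * ENNReal.ofReal η₂ := by ring
        _ ≤ _ := by gcongr; exact mul_le_of_le_one_left' (M.discount_le_one τ)
  have hae : ∀ᵐ ω ∂(ξ.law x), ω 0 = x ∧ ω 1 ≠ e :=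
    (ξ.law_start x).and (law_first_posterior_ne x he)
  set ξ' := ξ.redirect x y e τ F hF with hξ'
  have hcost : ξ'.totalCost y ≤ ξ.totalCost x + ENNReal.ofReal η₂ := by
    refine (redirect_totalCost_le hab hFdef he).trans ?_
    have h1 : ∫⁻ ω, ξ'.pathCost (Function.update ω 0 y) ∂(ξ.law x) ≤
        ξ.totalCost x + ENNReal.ofReal η₂ := by
      have : ∫⁻ ω, (ξ.pathCost ω + ENNReal.ofReal η₂) ∂(ξ.law x) =
          ξ.totalCost x + ENNReal.ofReal η₂ := by
        rw [lintegral_add_right _ measurable_const, totalCost_eq]; simp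
      rw [← this]
      refine lintegral_mono_ae ?_
      filter_upwards [hae] with ω hω
      rw [pathCost_eq, pathCost_eq, redirect_exper_zero, redirect_acqTime hτ hω.1 hω.2,
        add_right_comm]
      refine add_le_add ?_ (le_of_eq ?_)
      · rw [acqTime_succ, hist_zero_eq, hω.1]
        simpa [acqTime] using hdc
      · refine tsum_congr fun n => ?_
        rw [redirect_acqTime hτ hω.1 hω.2, redirect_exper_succ ω n hω.1 hω.2]
    have h2 : ξ'.pathCost (constAfter y e) ≤ ξ.totalCost x + ENNReal.ofReal η₂ := by
      rw [hξ', redirect_pathCost_constAfter]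
      refine hdc.trans ?_
      gcongr
      exact le_totalCost ξ x
    calc _ ≤ a * (ξ.totalCost x + ENNReal.ofReal η₂) +
          b * (ξ.totalCost x + ENNReal.ofReal η₂) := by gcongr
      _ = _ := by rw [← add_mul, hab, one_mul]
  have hcost' : (ξ'.totalCost y).toReal ≤ (ξ.totalCost x).toReal + η₂ := by
    have := ENNReal.toReal_mono (ENNReal.add_ne_top.2 ⟨hx, ENNReal.ofReal_ne_top⟩) hcost
    rwa [ENNReal.toReal_add hx ENNReal.ofReal_ne_top, ENNReal.toReal_ofReal hη₂] at this
  have hne : ξ'.totalCost y ≠ ⊤ :=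
    ne_top_of_le_ne_top (ENNReal.add_ne_top.2 ⟨hx, ENNReal.ofReal_ne_top⟩) hcost
  have hpu : ξ.utility x - η₁ / M.r ≤
      ∫ ω, ξ'.pathUtility (Function.update ω 0 y) ∂(ξ.law x) := by
    have e1 : ξ.utility x - η₁ / M.r = ∫ ω, (ξ.pathUtility ω - η₁ / M.r) ∂(ξ.law x) := by
      rw [integral_sub (ξ.integrable_pathUtility _) (integrable_const _), utility_eq]; simp
    have hΦ := measurable_update_zero y
    have : IsProbabilityMeasure ((ξ.law x).map (fun ω => Function.update ω 0 y)) :=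
      Measure.isProbabilityMeasure_map hΦ.aemeasurable
    rw [e1]
    refine integral_mono_ae ((ξ.integrable_pathUtility _).sub (integrable_const _))
      ((ξ'.integrable_pathUtility ((ξ.law x).map
        (fun ω => Function.update ω 0 y))).comp_measurable hΦ) ?_
    filter_upwards [hae] with ω hω
    have := abs_pathUtility_sub_le (ξ₁ := ξ') (ξ₂ := ξ) (ω₁ := Function.update ω 0 y) (ω₂ := ω)
      (redirect_acqTime hτ hω.1 hω.2) (fun n => by simp) (η := η₁)
      (by intro t; simpa [hω.1] using hu t)
    linarith [(abs_le.1 this).1]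
  have hut : ξ'.utility y = (1 - ε) * ∫ ω, ξ'.pathUtility (Function.update ω 0 y) ∂(ξ.law x) +
      ε * ξ'.pathUtility (constAfter y e) := by
    rw [hξ', redirect_utility hab hFdef he, ENNReal.toReal_ofReal (by linarith),
      ENNReal.toReal_ofReal hε0]
  have hv := M.le_value ξ' hne
  -- With weight `ε`, a utility of at most `utilityBound / r` is exchanged for one of at least its
  -- negative; hence the term `2 * ε * (utilityBound / r)`.
  have hB := (abs_le.1 (ξ'.abs_pathUtility_le (constAfter y e))).1
  have hB2 := (abs_le.1 (ξ.abs_utility_le x)).2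
  have hr : 0 ≤ η₁ / M.r := div_nonneg hη₁ M.r_pos.le
  have h3 := mul_le_mul_of_nonneg_left hpu (by linarith : 0 ≤ 1 - ε)
  have h4 := mul_le_mul_of_nonneg_left hB hε0
  have h5 := mul_le_mul_of_nonneg_left hB2 hε0
  have h6 := mul_nonneg hε0 hr
  nlinarith

end Redirect

end Policy

/-! ### Continuity of the value at interior beliefs. -/

theorem exists_mem_Ioo_measure_singleton_eq_zero (F : Measure Belief) [IsFiniteMeasure F]
    {l h : ℝ} (hl : 0 ≤ l) (hlh : l < h) (hh : h ≤ 1) :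
    ∃ e : Belief, l < e ∧ (e : ℝ) < h ∧ F {e} = 0 := by
  by_contra hcon
  push Not at hcon
  -- A finite measure has countably many atoms, whereas an interval is uncountable.
  have hcount : Set.Countable {q : Belief | 0 < F {q}} :=
    Measure.countable_meas_pos_of_disjoint_iUnion (fun q => measurableSet_singleton q)
      fun a b hab => by simpa [Function.onFun] using hab
  have h2 : (Set.Ioo l h).Countable := by
    refine (hcount.image (fun q : Belief => (q : ℝ))).mono fun z hz => ?_
    exact ⟨⟨z, hl.trans hz.1.le, hz.2.le.trans hh⟩,
      pos_iff_ne_zero.2 (hcon ⟨z, hl.trans hz.1.le, hz.2.le.trans hh⟩ hz.1 hz.2), rfl⟩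
  exact absurd (Cardinal.Real.Ioo_countable_iff.1 h2) (not_le.2 hlh)

namespace Model

variable (M : Model)

theorem longRun_pos : 0 < M.longRun := div_pos M.rate0_pos M.rate_pos

theorem longRun_lt_one : M.longRun < 1 := by
  have h : 0 < M.rate0 + M.rate1 := M.rate_pos
  rw [longRun, div_lt_one h]; linarith [M.rate1_pos]

theorem exp_neg_rate_mem (t : ℝ≥0) :
    0 < Real.exp (-M.rate * t) ∧ Real.exp (-M.rate * t) ≤ 1 := by
  refine ⟨Real.exp_pos _, ?_⟩
  rw [Real.exp_le_one_iff]
  nlinarith [M.rate_pos, t.2, show (0 : ℝ) ≤ t from t.2]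

theorem drift_mem_Icc {α β : ℝ} (h1 : α ≤ M.longRun) (h2 : M.longRun ≤ β) {q : Belief}
    (hq : (q : ℝ) ∈ Set.Icc α β) (t : ℝ≥0) : (M.drift q t : ℝ) ∈ Set.Icc α β := by
  obtain ⟨h3, h4⟩ := M.exp_neg_rate_mem t
  have : (M.drift q t : ℝ) = Real.exp (-M.rate * t) * q +
    (1 - Real.exp (-M.rate * t)) * M.longRun := rfl
  rw [this]
  exact (convex_Icc α β) hq ⟨h1, h2⟩ h3.le (sub_nonneg.2 h4) (by ring)

theorem abs_drift_sub_le (x y : Belief) (t : ℝ≥0) :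
    |(M.drift x t : ℝ) - M.drift y t| ≤ |(x : ℝ) - y| := by
  obtain ⟨h3, h4⟩ := M.exp_neg_rate_mem t
  rw [coe_drift, coe_drift]
  have : M.longRun + Real.exp (-M.rate * t) * (x - M.longRun) -
      (M.longRun + Real.exp (-M.rate * t) * (y - M.longRun)) =
      Real.exp (-M.rate * t) * (x - y) := by ring
  rw [this, abs_mul, abs_of_pos h3]
  exact mul_le_of_le_one_left (abs_nonneg _) h4

/-- Near an interior belief the value changes little, in both directions. -/
theorem exists_value_sub_le {p : Belief} (hp0 : 0 < (p : ℝ)) (hp1 : (p : ℝ) < 1) {η : ℝ}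
    (hη : 0 < η) : ∃ δ > 0, ∀ x y : Belief, |(x : ℝ) - p| < δ → |(y : ℝ) - p| < δ →
      M.value x - η ≤ M.value y := by
  have hπ0 := M.longRun_pos
  have hπ1 := M.longRun_lt_one
  -- An interval `[α, β]` inside `(0, 1)` around both `p` and the long-run belief is invariant under
  -- the drift. The wider interval used below leaves room for the extra posterior, and `c` is
  -- bounded and uniformly continuous on it.
  obtain ⟨α, hα0, hαp, hαπ⟩ : ∃ α : ℝ, 0 < α ∧ α < p ∧ α < M.longRun :=
    ⟨min (p : ℝ) M.longRun / 2, by positivity,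
      by linarith [min_le_left (p : ℝ) M.longRun, lt_min hp0 hπ0],
      by linarith [min_le_right (p : ℝ) M.longRun, lt_min hp0 hπ0]⟩
  obtain ⟨β, hβ1, hpβ, hπβ⟩ : ∃ β : ℝ, β < 1 ∧ (p : ℝ) < β ∧ M.longRun < β :=
    ⟨(1 + max (p : ℝ) M.longRun) / 2, by linarith [max_lt hp1 hπ1],
      by linarith [le_max_left (p : ℝ) M.longRun, max_lt hp1 hπ1],
      by linarith [le_max_right (p : ℝ) M.longRun, max_lt hp1 hπ1]⟩
  have hsub : Set.Icc (α / 4) ((3 + β) / 4) ⊆ Set.Ioo 0 1 := fun z hz =>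
    ⟨by linarith [hz.1], by linarith [hz.2]⟩
  have hccont : ContinuousOn (fun z => (M.c z).toReal) (Set.Icc (α / 4) ((3 + β) / 4)) :=
    M.c_smooth.continuousOn.mono hsub
  obtain ⟨Cm, hCm⟩ := isCompact_Icc.exists_bound_of_continuousOn hccont
  have hCm0 : 0 ≤ Cm := (norm_nonneg _).trans (hCm p ⟨by linarith, by linarith⟩)
  have hcu := isCompact_Icc.uniformContinuousOn_of_continuous hccont
  rw [Metric.uniformContinuousOn_iff] at hcu
  obtain ⟨δc, hδc, hcu⟩ := hcu (η / 8) (by positivity)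
  have huu := CompactSpace.uniformContinuous_of_continuous M.continuous_u
  rw [Metric.uniformContinuous_iff] at huu
  have hr := M.r_pos
  obtain ⟨δu, hδu, huu⟩ := huu (M.r * (η / 8)) (by positivity)
  have hB := M.utilityBound_nonneg
  set D := 2 * (M.utilityBound / M.r) + Cm with hD
  have hD0 : 0 ≤ D := by positivity
  -- A lower bound on the distance from `[α, β]` to the extra posterior; the weight of that
  -- posterior is then at most `2 * δ / g ≤ ε₀`.
  set g := min (α / 2) ((1 - β) / 2) with hg
  have hg0 : 0 < g := lt_min (by linarith) (by linarith)
  set ε₀ := min 1 (η / 8 / (D + 1)) with hε₀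
  have hε₀0 : 0 < ε₀ := lt_min one_pos (by positivity)
  have hε₀D : D * ε₀ ≤ η / 8 := by
    have : ε₀ * (D + 1) ≤ η / 8 := by
      rw [← le_div_iff₀ (by positivity)]; exact min_le_right _ _
    nlinarith
  set δ := min (min (δc / 2) (δu / 2)) (min (g * ε₀ / 2) (min (p - α) (β - p))) with hδ
  have hδ0 : 0 < δ := by
    refine lt_min (lt_min (by positivity) (by positivity)) (lt_min (by positivity) (lt_min ?_ ?_))
    · linarith
    · linarith
  have d1 : δ ≤ δc / 2 := (min_le_left _ _).trans (min_le_left _ _)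
  have d2 : δ ≤ δu / 2 := (min_le_left _ _).trans (min_le_right _ _)
  have d3 : δ ≤ g * ε₀ / 2 := (min_le_right _ _).trans (min_le_left _ _)
  have d4 : δ ≤ p - α := (min_le_right _ _).trans ((min_le_right _ _).trans (min_le_left _ _))
  have d5 : δ ≤ β - p := (min_le_right _ _).trans ((min_le_right _ _).trans (min_le_right _ _))
  refine ⟨δ, hδ0, fun x y hx hy => ?_⟩
  have hxy : |(y : ℝ) - x| < 2 * δ := by
    rw [abs_lt] at *; constructor <;> linarith
  rw [abs_lt] at hx hy
  obtain ⟨ξ, hξ, hξv⟩ := M.exists_policy_near_value x (half_pos hη)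
  -- If the policy never acquires, `s` is `0` by default; the facts about `s` hold all the same and
  -- are not needed then.
  set s := (ξ.wait 0 fun _ => x).toNNReal with hs
  have hxs := M.drift_mem_Icc hαπ.le hπβ.le (q := x) ⟨by linarith, by linarith⟩ s
  have hys := M.drift_mem_Icc hαπ.le hπβ.le (q := y) ⟨by linarith, by linarith⟩ s
  have hd := (M.abs_drift_sub_le y x s).trans_lt hxy
  -- The extra posterior lies beyond `[α, β]` on the side towards which the mean must be moved, off
  -- the atoms of the first experiment; `d` solves the mean equation.
  obtain ⟨e, heF, heK, d, hd0, hdε, hdeq⟩ : ∃ e : Belief, ξ.exper 0 (fun _ => x) {e} = 0 ∧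
      (e : ℝ) ∈ Set.Icc (α / 4) ((3 + β) / 4) ∧ ∃ d : ℝ, 0 ≤ d ∧ d ≤ ε₀ ∧
      (1 - d) * (M.drift x s : ℝ) + d * e = M.drift y s := by
    rcases le_total (M.drift x s : ℝ) (M.drift y s) with hle | hle
    · obtain ⟨e, h1, h2, h3⟩ := exists_mem_Ioo_measure_singleton_eq_zero
        (ξ.exper 0 fun _ => x) (l := (1 + β) / 2) (h := (3 + β) / 4) (by linarith)
        (by linarith) (by linarith)
      have hpos : g ≤ e - M.drift x s := by
        have := min_le_right (α / 2) ((1 - β) / 2)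
        linarith [hxs.2]
      refine ⟨e, h3, ⟨by linarith, h2.le⟩, (M.drift y s - M.drift x s) / (e - M.drift x s),
        div_nonneg (by linarith) (by linarith), ?_, ?_⟩
      · rw [div_le_iff₀ (by linarith)]
        have := (abs_lt.1 hd).2
        nlinarith
      · have : (e : ℝ) - M.drift x s ≠ 0 := by linarith
        field_simp
        ring
    · obtain ⟨e, h1, h2, h3⟩ := exists_mem_Ioo_measure_singleton_eq_zero
        (ξ.exper 0 fun _ => x) (l := α / 4) (h := α / 2) (by linarith)
        (by linarith) (by linarith)
      have hpos : g ≤ M.drift x s - e := by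
        have := min_le_left (α / 2) ((1 - β) / 2)
        linarith [hxs.1]
      refine ⟨e, h3, ⟨h1.le, by linarith⟩, (M.drift x s - M.drift y s) / (M.drift x s - e),
        div_nonneg (by linarith) (by linarith), ?_, ?_⟩
      · rw [div_le_iff₀ (by linarith)]
        have := (abs_lt.1 hd).1
        nlinarith
      · have : (M.drift x s : ℝ) - e ≠ 0 := by linarith
        field_simp
        ring
  have hKx : (M.drift x s : ℝ) ∈ Set.Icc (α / 4) ((3 + β) / 4) :=
    ⟨by linarith [hxs.1], by linarith [hxs.2]⟩
  have hKy : (M.drift y s : ℝ) ∈ Set.Icc (α / 4) ((3 + β) / 4) :=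
    ⟨by linarith [hys.1], by linarith [hys.2]⟩
  have hcfin : ∀ z ∈ Set.Icc (α / 4) ((3 + β) / 4), M.c z = ENNReal.ofReal (M.c z).toReal :=
    fun z hz => (ENNReal.ofReal_toReal (M.c_finite z (hsub hz))).symm
  have hcxy := hcu _ hKx _ hKy (by
    rw [Real.dist_eq, abs_sub_comm]; exact hd.trans_le (by linarith))
  rw [Real.dist_eq] at hcxy
  have hce := (le_abs_self _).trans (hCm e heK)
  -- The losses are `η / 2` for near optimality and `η / 8` each for the modulus of `u`, the modulus
  -- of `c` and the weight `d`.
  have hkey := ξ.le_value_of_mixture (x := x) (y := y) (e := e) (ε := d)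
    (η₁ := M.r * (η / 8)) (η₂ := η / 8 + d * Cm) hd0 (hdε.trans (min_le_left _ _)) (by positivity)
    hξ (fun _ => hdeq) heF (fun t => by
      have := huu (a := M.drift y t) (b := M.drift x t) (by
        rw [Subtype.dist_eq, Real.dist_eq]
        exact (M.abs_drift_sub_le y x t).trans_lt (hxy.trans_le (by linarith)))
      exact this.le)
    (fun _ => by
      rw [hcfin _ hKx, hcfin _ hKy, hcfin _ heK, ← ENNReal.ofReal_mul hd0,
        ← ENNReal.ofReal_add ENNReal.toReal_nonneg (by positivity),
        ← ENNReal.ofReal_add ENNReal.toReal_nonneg (by positivity)]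
      apply ENNReal.ofReal_le_ofReal
      have := (abs_lt.1 hcxy).2
      have := mul_le_mul_of_nonneg_left hce hd0
      linarith)
    (by positivity)
  have e1 : M.r * (η / 8) / M.r = η / 8 := by field_simp
  rw [e1] at hkey
  have e2 : d * D ≤ η / 8 := by
    have := mul_le_mul_of_nonneg_right hdε hD0
    linarith
  have e3 : d * D = 2 * d * (M.utilityBound / M.r) + d * Cm := by rw [hD]; ring
  linarith

theorem continuousAt_value_of_mem_Ioo {p : Belief} (hp : (p : ℝ) ∈ Set.Ioo 0 1) :
    ContinuousAt M.value p := by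
  rw [Metric.continuousAt_iff]
  intro η hη
  obtain ⟨δ, hδ, h⟩ := M.exists_value_sub_le hp.1 hp.2 (half_pos hη)
  refine ⟨δ, hδ, fun {x} hx => ?_⟩
  rw [Subtype.dist_eq, Real.dist_eq] at hx
  have h1 := h x p hx (by simpa using hδ)
  have h2 := h p x (by simpa using hδ) hx
  rw [Real.dist_eq, abs_lt]
  constructor <;> linarith

end Model

/-! ### Shifting a policy in time. -/

namespace Policy

variable {M : Model}

section TimeShift

variable {ξ₁ ξ₂ : Policy M} {ω₁ ω₂ : ℕ → Belief} {s : ℝ≥0}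

/-- Up to the first acquisition this is the semigroup property of the drift, afterwards elapsed
times agree. The accumulation convention is compatible with the shift because it drifts from the
initial beliefs. -/
theorem belief_add_of_shift (hacq : ∀ n, ξ₂.acqTime (n + 1) ω₂ = ξ₁.acqTime (n + 1) ω₁ + s)
    (hω : ∀ n, ω₁ (n + 1) = ω₂ (n + 1)) (h0 : ω₁ 0 = M.drift (ω₂ 0) s) (t : ℝ≥0) :
    ξ₂.belief ω₂ (t + s) = ξ₁.belief ω₁ t := by
  rcases ξ₁.exists_index_or ω₁ t with ⟨n, h1, h2⟩ | h
  · have h3 : ((t + s : ℝ≥0) : ℝ≥0∞) < ξ₂.acqTime (n + 1) ω₂ := by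
      rw [hacq, ENNReal.coe_add]
      exact ENNReal.add_lt_add_right ENNReal.coe_ne_top h2
    rw [ξ₁.belief_eq h1 h2]
    rcases n with _ | n
    · rw [ξ₂.belief_eq (n := 0) (by simp [acqTime]) h3, h0, ← M.drift_add]
      simp [acqTime, add_comm]
    · have h4 : ξ₂.acqTime (n + 1) ω₂ ≤ (t + s : ℝ≥0) := by
        rw [hacq, ENNReal.coe_add]; gcongr
      have hne : ξ₁.acqTime (n + 1) ω₁ ≠ ⊤ := ne_top_of_le_ne_top ENNReal.coe_ne_top h1
      rw [ξ₂.belief_eq h4 h3, hω, hacq, ENNReal.toNNReal_add hne ENNReal.coe_ne_top,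
        ENNReal.toNNReal_coe, add_tsub_add_eq_tsub_right]
  · rw [ξ₁.belief_eq_of_forall_le h, ξ₂.belief_eq_of_forall_le, h0, ← M.drift_add, add_comm]
    rintro (_ | n)
    · simp [acqTime]
    · rw [hacq, ENNReal.coe_add]; gcongr; exact h _

/-- Cutting the integral at `s`, the tail is exactly the discounted utility of the other path, and
the head is at most `utilityBound * s`. -/
theorem abs_pathUtility_sub_of_shift
    (hacq : ∀ n, ξ₂.acqTime (n + 1) ω₂ = ξ₁.acqTime (n + 1) ω₁ + s)
    (hω : ∀ n, ω₁ (n + 1) = ω₂ (n + 1)) (h0 : ω₁ 0 = M.drift (ω₂ 0) s) :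
    |ξ₂.pathUtility ω₂ - Real.exp (-M.r * s) * ξ₁.pathUtility ω₁| ≤ M.utilityBound * s := by
  have hs : (0 : ℝ) ≤ s := s.2
  have hi := ξ₂.integrableOn_flow ω₂
  have hsplit : ξ₂.pathUtility ω₂ =
      (∫ t in Set.Ioc (0 : ℝ) s, ξ₂.flow ω₂ t) + ∫ t in Set.Ioi (s : ℝ), ξ₂.flow ω₂ t := by
    rw [pathUtility, ← Set.Ioc_union_Ioi_eq_Ioi hs]
    exact setIntegral_union (Set.Ioc_disjoint_Ioi le_rfl) measurableSet_Ioi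
      (hi.mono_set Set.Ioc_subset_Ioi_self) (hi.mono_set (Set.Ioi_subset_Ioi hs))
  have htail : ∫ t in Set.Ioi (s : ℝ), ξ₂.flow ω₂ t =
      Real.exp (-M.r * s) * ξ₁.pathUtility ω₁ := by
    have h1 := (measurePreserving_add_right volume (s : ℝ)).setIntegral_preimage_emb
      (MeasurableEquiv.addRight (s : ℝ)).measurableEmbedding (ξ₂.flow ω₂) (Set.Ioi (s : ℝ))
    rw [← h1, Set.preimage_add_const_Ioi, sub_self, pathUtility, ← integral_const_mul]
    refine setIntegral_congr_fun measurableSet_Ioi fun t ht => ?_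
    have ht : (0 : ℝ) < t := ht
    simp only [flow]
    rw [Real.toNNReal_add ht.le hs, Real.toNNReal_coe, belief_add_of_shift hacq hω h0,
      mul_add, Real.exp_add]
    ring
  have hhead : |∫ t in Set.Ioc (0 : ℝ) s, ξ₂.flow ω₂ t| ≤ M.utilityBound * s := by
    have := norm_setIntegral_le_of_norm_le_const (f := ξ₂.flow ω₂) (s := Set.Ioc (0 : ℝ) s)
      (μ := volume) (C := M.utilityBound) (by simp) (fun t ht => by
        refine (ξ₂.abs_flow_le ω₂ t).trans ?_
        refine mul_le_of_le_one_right M.utilityBound_nonneg ?_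
        rw [Real.exp_le_one_iff]
        nlinarith [ht.1, M.r_pos])
    simpa using this
  rw [hsplit, htail]
  simpa using hhead

theorem pathCost_of_shift (hacq : ∀ n, ξ₂.acqTime (n + 1) ω₂ = ξ₁.acqTime (n + 1) ω₁ + s)
    (hF : ∀ n, ξ₂.exper n (hist ω₂ n) = ξ₁.exper n (hist ω₁ n)) :
    ξ₂.pathCost ω₂ = ENNReal.ofReal (Real.exp (-M.r * s)) * ξ₁.pathCost ω₁ := by
  unfold pathCost
  rw [← ENNReal.tsum_mul_left]
  refine tsum_congr fun n => ?_
  rw [hacq, M.discount_add_coe, hF, mul_assoc]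

end TimeShift

/-- Both time shifts of a policy: acquiring the same first experiment from `y` as from `x`. -/
theorem exists_redirect_same_experiment (ξ : Policy M) {x y : Belief} {τ : ℝ≥0∞}
    (hF : τ ≠ ⊤ → ∫ q, (q : ℝ) ∂(ξ.exper 0 fun _ => x) = (M.drift y τ.toNNReal : ℝ)) :
    ∃ ξ' : Policy M, (∀ᵐ ω ∂(ξ.law x), ω 0 = x ∧
        (∀ s s' : ℝ≥0∞, τ + s = ξ.wait 0 (fun _ => x) + s' → ∀ n,
          ξ'.acqTime (n + 1) (Function.update ω 0 y) + s = ξ.acqTime (n + 1) ω + s') ∧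
        ∀ n, ξ'.exper n (hist (Function.update ω 0 y) n) = ξ.exper n (hist ω n)) ∧
      ξ'.utility y = ∫ ω, ξ'.pathUtility (Function.update ω 0 y) ∂(ξ.law x) ∧
      ξ'.totalCost y ≤ ∫⁻ ω, ξ'.pathCost (Function.update ω 0 y) ∂(ξ.law x) := by
  obtain ⟨e, -, -, he⟩ := exists_mem_Ioo_measure_singleton_eq_zero
    (ξ.exper 0 fun _ => x) le_rfl one_pos le_rfl
  -- The mixture has weight `0` on `e`, so the experiment is unchanged and `e` is a dummy.
  have hF2 : ξ.exper 0 (fun _ => x) =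
      (1 : ℝ≥0∞) • ξ.exper 0 (fun _ => x) + (0 : ℝ≥0∞) • Measure.dirac e := by simp
  refine ⟨ξ.redirect x y e τ _ hF, ?_, ?_, ?_⟩
  · filter_upwards [ξ.law_start x, law_first_posterior_ne x he] with ω h0 h1
    refine ⟨h0, fun s s' h n => redirect_acqTime_add h h0 h1 n, ?_⟩
    rintro (_ | n)
    · rw [redirect_exper_zero, hist_zero_eq, h0]
    · exact redirect_exper_succ ω n h0 h1
  · rw [redirect_utility (by simp) hF2 he]; simp
  · refine (redirect_totalCost_le (by simp) hF2 he).trans ?_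
    simp

theorem integrable_pathUtility_update (ξ' ξ : Policy M) (x y : Belief) :
    Integrable (fun ω => ξ'.pathUtility (Function.update ω 0 y)) (ξ.law x) := by
  have hΦ := measurable_update_zero y
  have : IsProbabilityMeasure ((ξ.law x).map (fun ω => Function.update ω 0 y)) :=
    Measure.isProbabilityMeasure_map hΦ.aemeasurable
  exact (ξ'.integrable_pathUtility ((ξ.law x).map
        (fun ω => Function.update ω 0 y))).comp_measurable hΦ

end Policy

namespace Model

variable (M : Model)

/-- Waiting is always possible. -/
theorem exp_mul_value_drift_le (y : Belief) (s : ℝ≥0) :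
    Real.exp (-M.r * s) * M.value (M.drift y s) - M.utilityBound * s ≤ M.value y := by
  refine le_of_forall_pos_le_add fun η hη => ?_
  set x := M.drift y s with hx
  set E := Real.exp (-M.r * s)
  have hE : 0 < E := Real.exp_pos _
  have hE1 : E ≤ 1 := by
    rw [Real.exp_le_one_iff]; nlinarith [M.r_pos, show (0 : ℝ) ≤ s from s.2]
  obtain ⟨ξ, hξ, hξv⟩ := M.exists_policy_near_value x hη
  obtain ⟨ξ', hae, hut, hco⟩ := ξ.exists_redirect_same_experiment (x := x) (y := y)
    (τ := ξ.wait 0 (fun _ => x) + s) (fun h => by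
      have h1 : ξ.wait 0 (fun _ => x) ≠ ⊤ := fun h1 => h (by simp [h1])
      rw [ξ.bayes 0 _ h1, ENNReal.toNNReal_add h1 ENNReal.coe_ne_top, ENNReal.toNNReal_coe,
        add_comm, M.drift_add]
      rfl)
  have hacq : ∀ᵐ ω ∂(ξ.law x), ∀ n,
      ξ'.acqTime (n + 1) (Function.update ω 0 y) = ξ.acqTime (n + 1) ω + s := by
    filter_upwards [hae] with ω hω n
    simpa using hω.2.1 0 s (by simp) n
  have h1 : E * ξ.utility x - M.utilityBound * s ≤ ξ'.utility y := by
    have e1 : E * ξ.utility x - M.utilityBound * s =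
        ∫ ω, (E * ξ.pathUtility ω - M.utilityBound * s) ∂(ξ.law x) := by
      rw [integral_sub ((ξ.integrable_pathUtility _).const_mul _) (integrable_const _),
        integral_const_mul, Policy.utility_eq]; simp
    rw [e1, hut]
    refine integral_mono_ae (((ξ.integrable_pathUtility _).const_mul _).sub (integrable_const _))
      (Policy.integrable_pathUtility_update ξ' ξ x y) ?_
    filter_upwards [hae, hacq] with ω hω hω2
    have := Policy.abs_pathUtility_sub_of_shift (ξ₁ := ξ) (ξ₂ := ξ') hω2 (fun n => by simp)
      (by simp [hω.1, hx])
    linarith [(abs_le.1 this).1]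
  have h2 : ξ'.totalCost y ≤ ENNReal.ofReal E * ξ.totalCost x := by
    refine hco.trans ?_
    rw [Policy.totalCost_eq, ← lintegral_const_mul' _ _ ENNReal.ofReal_ne_top]
    refine lintegral_mono_ae ?_
    filter_upwards [hae, hacq] with ω hω hω2
    exact (Policy.pathCost_of_shift (ξ₁ := ξ) (ξ₂ := ξ') hω2 hω.2.2).le
  have hne := ENNReal.mul_ne_top (a := ENNReal.ofReal E) ENNReal.ofReal_ne_top hξ
  have h3 := ENNReal.toReal_mono hne h2
  rw [ENNReal.toReal_mul, ENNReal.toReal_ofReal hE.le] at h3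
  have h4 := M.le_value ξ' (ne_top_of_le_ne_top hne h2)
  have h5 := mul_le_mul_of_nonneg_left hξv.le hE.le
  nlinarith

/-- A policy that waits initially loses little when the belief has drifted for a short time. -/
theorem payoff_sub_le_exp_mul_value_drift (ξ : Policy M) {x : Belief} {s : ℝ≥0}
    (hξ : ξ.totalCost x ≠ ⊤) (hs : (s : ℝ≥0∞) ≤ ξ.wait 0 fun _ => x) :
    ξ.utility x - (ξ.totalCost x).toReal - M.utilityBound * s ≤
      Real.exp (-M.r * s) * M.value (M.drift x s) := by
  set y := M.drift x s with hy
  set E := Real.exp (-M.r * s)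
  have hE : 0 < E := Real.exp_pos _
  have hsub : ξ.wait 0 (fun _ => x) - s + s = ξ.wait 0 (fun _ => x) := tsub_add_cancel_of_le hs
  obtain ⟨ξ', hae, hut, hco⟩ := ξ.exists_redirect_same_experiment (x := x) (y := y)
    (τ := ξ.wait 0 (fun _ => x) - s) (fun h => by
      have h1 : ξ.wait 0 (fun _ => x) ≠ ⊤ := by
        rw [← hsub]; exact ENNReal.add_ne_top.2 ⟨h, ENNReal.coe_ne_top⟩
      rw [ξ.bayes 0 _ h1, hy, ← M.drift_add, ← ENNReal.toNNReal_coe s,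
        ← ENNReal.toNNReal_add ENNReal.coe_ne_top (by simpa using h), ENNReal.toNNReal_coe,
        add_comm, hsub]
      rfl)
  have hacq : ∀ᵐ ω ∂(ξ.law x), ∀ n,
      ξ.acqTime (n + 1) ω = ξ'.acqTime (n + 1) (Function.update ω 0 y) + s := by
    filter_upwards [hae] with ω hω n
    simpa using (hω.2.1 s 0 (by simpa using hsub) n).symm
  have h1 : ξ.utility x - M.utilityBound * s ≤ E * ξ'.utility y := by
    have e1 : ξ.utility x - M.utilityBound * s =
        ∫ ω, (ξ.pathUtility ω - M.utilityBound * s) ∂(ξ.law x) := by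
      rw [integral_sub (ξ.integrable_pathUtility _) (integrable_const _), Policy.utility_eq]; simp
    rw [e1, hut, ← integral_const_mul]
    refine integral_mono_ae ((ξ.integrable_pathUtility _).sub (integrable_const _))
      ((Policy.integrable_pathUtility_update ξ' ξ x y).const_mul _) ?_
    filter_upwards [hae, hacq] with ω hω hω2
    have := Policy.abs_pathUtility_sub_of_shift (ξ₁ := ξ') (ξ₂ := ξ) hω2 (fun n => by simp)
      (by simp [hω.1, hy])
    linarith [(abs_le.1 this).2]
  have h2 : ENNReal.ofReal E * ξ'.totalCost y ≤ ξ.totalCost x := by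
    refine (mul_le_mul_right hco _).trans ?_
    rw [Policy.totalCost_eq, ← lintegral_const_mul' _ _ ENNReal.ofReal_ne_top]
    refine lintegral_mono_ae ?_
    filter_upwards [hae, hacq] with ω hω hω2
    exact (Policy.pathCost_of_shift (ξ₁ := ξ') (ξ₂ := ξ) hω2 fun n => (hω.2.2 n).symm).ge
  -- The discount factor is positive, so an infinite continuation cost would make the original cost
  -- infinite.
  have hne : ξ'.totalCost y ≠ ⊤ := by
    intro h
    rw [h, ENNReal.mul_top (by simpa using hE)] at h2
    exact hξ (top_le_iff.1 h2)
  have h3 := ENNReal.toReal_mono hξ h2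
  rw [ENNReal.toReal_mul, ENNReal.toReal_ofReal hE.le] at h3
  have h4 := mul_le_mul_of_nonneg_left (M.le_value ξ' hne) hE.le
  nlinarith

end Model

/-! ### Skipping an uninformative immediate acquisition. -/

namespace History

/-- The history preceded by the belief `b`. -/
def cons (b : Belief) {n : ℕ} (h : History n) : History (n + 1) := fun i =>
  if (i : ℕ) = 0 then b else
    h ⟨i - 1, Finset.mem_Iic.2 (Nat.sub_le_iff_le_add.2 (Finset.mem_Iic.1 i.2))⟩

/-- The history without its initial belief. -/
def tail {n : ℕ} (h : History (n + 1)) : History n := fun i =>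
  h ⟨i + 1, Finset.mem_Iic.2 (Nat.succ_le_succ (Finset.mem_Iic.1 i.2))⟩

theorem measurable_cons (b : Belief) {n : ℕ} : Measurable (cons b (n := n)) := by
  refine measurable_pi_lambda _ fun i => ?_
  unfold cons
  split_ifs
  · exact measurable_const
  · exact measurable_apply _

theorem measurable_tail {n : ℕ} : Measurable (tail (n := n)) :=
  measurable_pi_lambda _ fun _ => measurable_apply _

theorem last_cons (b : Belief) {n : ℕ} (h : History n) : (cons b h).last = h.last := by
  simp [last, cons]

end History

namespace Policy

variable {M : Model} (ξ : Policy M)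

/-- The policy that continues as `ξ` would if the present posterior were the first one and the
initial belief had been `b`. -/
def afterFirst (b : Belief) : Policy M where
  wait n h := ξ.wait (n + 1) (h.cons b)
  measurable_wait n := (ξ.measurable_wait (n + 1)).comp (History.measurable_cons b)
  exper n := Kernel.comap (ξ.exper (n + 1)) (History.cons b) (History.measurable_cons b)
  markov n := Kernel.IsMarkovKernel.comap (ξ.exper (n + 1)) (History.measurable_cons b)
  bayes n h hh := by
    rw [Kernel.comap_apply, ξ.bayes (n + 1) _ hh, History.last_cons]

variable {ξ}

theorem cons_hist_tail {b : Belief} {ω : ℕ → Belief} (h : ω 0 = b) (n : ℕ) :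
    (hist (fun k => ω (k + 1)) n).cons b = hist ω (n + 1) := by
  funext i
  unfold History.cons hist
  split_ifs with hi
  · rw [hi, h]
  · dsimp only
    congr 1
    omega

theorem measurable_tail : Measurable (fun (ω : ℕ → Belief) (k : ℕ) => ω (k + 1)) :=
  measurable_pi_lambda _ fun _ => measurable_pi_apply _

/-- Dropping the initial belief leaves a sequence starting at `b`, by `hb`; prefixing `b` again
recovers the full history on which `ξ` conditions. -/
theorem afterFirst_law {b : Belief} (hb : ∀ᵐ ω ∂(ξ.law b), ω 1 = b) :
    (ξ.afterFirst b).law b = (ξ.law b).map (fun ω k => ω (k + 1)) := by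
  symm
  have hm := measurable_tail
  apply IsLaw.eq_law
  refine ⟨Measure.isProbabilityMeasure_map hm.aemeasurable, ?_, ?_⟩
  · have h0 : MeasurableSet {ω : ℕ → Belief | ω 0 = b} :=
      measurable_pi_apply (X := fun _ : ℕ => Belief) 0 (measurableSet_singleton b)
    rw [ae_map_iff hm.aemeasurable h0]
    exact hb
  · intro n A B hA hB
    have hS1 : MeasurableSet {ω : ℕ → Belief | hist ω n ∈ A} := measurable_hist n hA
    have hS : MeasurableSet {ω : ℕ → Belief | hist ω n ∈ A ∧ ω (n + 1) ∈ B} :=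
      hS1.inter (measurable_pi_apply _ hB)
    have hf : Measurable (fun ω : ℕ → Belief => (ξ.afterFirst b).exper n (hist ω n) B) :=
      (Kernel.measurable_coe _ hB).comp (measurable_hist n)
    rw [setLIntegral_map hS1 hf hm, Measure.map_apply hm hS]
    have h := (ξ.isLaw_law b).step (n + 1) _ B (History.measurable_tail hA) hB
    refine h.trans ?_
    refine lintegral_congr_ae (ae_restrict_of_ae ?_)
    filter_upwards [ξ.law_start b] with ω hω
    have : (ξ.afterFirst b).exper n (hist (fun k => ω (k + 1)) n) =
        ξ.exper (n + 1) (hist ω (n + 1)) := by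
      rw [← cons_hist_tail hω]; rfl
    rw [this]

theorem afterFirst_acqTime {b : Belief} (hw : ξ.wait 0 (fun _ => b) = 0) {ω : ℕ → Belief}
    (h0 : ω 0 = b) (n : ℕ) :
    (ξ.afterFirst b).acqTime n (fun k => ω (k + 1)) = ξ.acqTime (n + 1) ω := by
  induction n with
  | zero => rw [acqTime_succ, hist_zero_eq, h0, hw]; simp [acqTime]
  | succ n ih =>
    rw [acqTime_succ, ih, acqTime_succ ξ (n + 1), ← cons_hist_tail h0]; rfl

/-- The condition `ω 1 = b` matters only past an accumulation of acquisitions, where the belief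
drifts from the initial entry of either sequence. -/
theorem afterFirst_belief {b : Belief} (hw : ξ.wait 0 (fun _ => b) = 0) {ω : ℕ → Belief}
    (h0 : ω 0 = b) (h1 : ω 1 = b) (t : ℝ≥0) :
    (ξ.afterFirst b).belief (fun k => ω (k + 1)) t = ξ.belief ω t := by
  rcases (ξ.afterFirst b).exists_index_or (fun k => ω (k + 1)) t with ⟨n, h2, h3⟩ | h
  · rw [(ξ.afterFirst b).belief_eq h2 h3]
    rw [afterFirst_acqTime hw h0] at h2 h3 ⊢
    rw [ξ.belief_eq h2 h3]
  · rw [(ξ.afterFirst b).belief_eq_of_forall_le h, ξ.belief_eq_of_forall_le, h0, zero_add, h1]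
    intro n
    refine (ξ.acqTime_mono ω n.le_succ).trans ?_
    have := h n
    rwa [afterFirst_acqTime hw h0] at this

theorem afterFirst_pathUtility {b : Belief} (hw : ξ.wait 0 (fun _ => b) = 0) {ω : ℕ → Belief}
    (h0 : ω 0 = b) (h1 : ω 1 = b) :
    (ξ.afterFirst b).pathUtility (fun k => ω (k + 1)) = ξ.pathUtility ω := by
  unfold pathUtility
  congr 1
  funext t
  rw [flow, flow, afterFirst_belief hw h0 h1]

theorem pathCost_eq_afterFirst {b : Belief} (hw : ξ.wait 0 (fun _ => b) = 0) {ω : ℕ → Belief}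
    (h0 : ω 0 = b) : ENNReal.ofReal M.fixedCost +
      (ξ.afterFirst b).pathCost (fun k => ω (k + 1)) ≤ ξ.pathCost ω := by
  rw [pathCost_eq ξ]
  refine add_le_add ?_ (le_of_eq ?_)
  · rw [← afterFirst_acqTime hw h0]
    simp [acqTime, M.discount_zero]
  · refine tsum_congr fun n => ?_
    rw [afterFirst_acqTime hw h0, ← cons_hist_tail h0]
    rfl

/-- An uninformative immediate acquisition wastes the fixed cost. -/
theorem payoff_add_fixedCost_le {b : Belief} (hw : ξ.wait 0 (fun _ => b) = 0)
    (hb : ∀ᵐ ω ∂(ξ.law b), ω 1 = b) (hξ : ξ.totalCost b ≠ ⊤) :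
    ξ.utility b - (ξ.totalCost b).toReal + M.fixedCost ≤ M.value b := by
  have hm := measurable_tail
  have h1 : (ξ.afterFirst b).utility b = ξ.utility b := by
    rw [utility_eq, utility_eq, afterFirst_law hb, integral_map hm.aemeasurable
      (ξ.afterFirst b).measurable_pathUtility.aestronglyMeasurable]
    refine integral_congr_ae ?_
    filter_upwards [ξ.law_start b, hb] with ω h0 h1
    exact afterFirst_pathUtility hw h0 h1
  have h2 : ENNReal.ofReal M.fixedCost + (ξ.afterFirst b).totalCost b ≤ ξ.totalCost b := by
    rw [totalCost_eq, totalCost_eq, afterFirst_law hb]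
    have e1 : ∫⁻ _, ENNReal.ofReal M.fixedCost ∂(ξ.law b) = ENNReal.ofReal M.fixedCost := by simp
    rw [← e1]
    refine (add_le_add le_rfl (lintegral_map_le _ _)).trans ?_
    rw [← lintegral_add_left measurable_const]
    refine lintegral_mono_ae ?_
    filter_upwards [ξ.law_start b] with ω h0
    exact pathCost_eq_afterFirst hw h0
  have hne : (ξ.afterFirst b).totalCost b ≠ ⊤ := ne_top_of_le_ne_top hξ (le_add_self.trans h2)
  have h3 := ENNReal.toReal_mono hξ h2
  rw [ENNReal.toReal_add ENNReal.ofReal_ne_top hne, ENNReal.toReal_ofReal M.fixedCost_pos.le] at h3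
  have h4 := M.le_value _ hne
  linarith

end Policy

/-! ### Continuity of the value at the endpoints. -/

theorem ae_eq_of_integral_eq_endpoint {F : Measure Belief} [IsProbabilityMeasure F] {b : Belief}
    (hb : (b : ℝ) = 0 ∨ (b : ℝ) = 1) (h : ∫ q, (q : ℝ) ∂F = b) : ∀ᵐ q ∂F, q = b := by
  have hint := integrable_coe F
  rcases hb with h0 | h1
  · rw [h0, integral_eq_zero_iff_of_nonneg (fun q => q.2.1) hint] at h
    filter_upwards [h] with q hq
    exact Subtype.ext (by rw [h0]; exact hq)
  · have h2 : ∫ q : Belief, (1 - (q : ℝ)) ∂F = 0 := by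
      rw [integral_sub (integrable_const _) hint, h, h1]; simp
    rw [integral_eq_zero_iff_of_nonneg (fun q => sub_nonneg.2 q.2.2)
      ((integrable_const _).sub hint)] at h2
    filter_upwards [h2] with q hq
    have hq : 1 - (q : ℝ) = 0 := hq
    exact Subtype.ext (by rw [h1]; linarith)

namespace Model

variable (M : Model)

/-- Every belief close to `b` lies on the drift path out of `b`. Waiting bounds the value at `b`
from below; from above, a nearly optimal policy at `b` waits for a positive time, so its
continuation is available at beliefs reached earlier. -/
theorem continuousAt_value_endpoint {b : Belief} (hb : (b : ℝ) = 0 ∨ (b : ℝ) = 1) :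
    ContinuousAt M.value b := by
  have hbπ : (b : ℝ) - M.longRun ≠ 0 := by
    rcases hb with h | h <;> rw [h]
    · linarith [M.longRun_pos]
    · linarith [M.longRun_lt_one]
  have hrate := M.rate_pos
  have hr := M.r_pos
  set B := M.utilityBound
  set U := B / M.r
  have hU : 0 ≤ U := div_nonneg M.utilityBound_nonneg hr.le
  -- The time needed to drift from `b` to `q`, continuous near `b` and zero at `b`.
  set S : Belief → ℝ := fun q => -Real.log (((q : ℝ) - M.longRun) / (b - M.longRun)) / M.rate
    with hS
  have hratio : ContinuousAt (fun q : Belief => ((q : ℝ) - M.longRun) / (b - M.longRun)) b := by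
    have : Continuous (fun q : Belief => ((q : ℝ) - M.longRun) / (b - M.longRun)) := by fun_prop
    exact this.continuousAt
  have hSc : ContinuousAt S b := by
    refine ContinuousAt.div_const (ContinuousAt.neg (hratio.log ?_)) _
    rw [div_self hbπ]; exact one_ne_zero
  have hSb : S b = 0 := by simp [hS, div_self hbπ]
  have hpos : ∀ᶠ q : Belief in 𝓝 b, 0 < ((q : ℝ) - M.longRun) / (b - M.longRun) := by
    refine hratio.eventually (lt_mem_nhds ?_)
    dsimp only
    rw [div_self hbπ]; exact one_pos
  have hle1 : ∀ q : Belief, ((q : ℝ) - M.longRun) / (b - M.longRun) ≤ 1 := by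
    intro q
    rcases hb with h | h
    · rw [h, div_le_one_of_neg (by linarith [M.longRun_pos])]
      linarith [q.2.1]
    · rw [h, div_le_one (by linarith [M.longRun_lt_one])]
      linarith [q.2.2]
  have hdrift : ∀ᶠ q in 𝓝 b, 0 ≤ S q ∧ M.drift b (S q).toNNReal = q := by
    filter_upwards [hpos] with q hq
    have hS0 : 0 ≤ S q :=
      div_nonneg (neg_nonneg.2 (Real.log_nonpos hq.le (hle1 q))) hrate.le
    refine ⟨hS0, Subtype.ext ?_⟩
    rw [coe_drift, Real.coe_toNNReal _ hS0]
    have : -M.rate * S q = Real.log (((q : ℝ) - M.longRun) / (b - M.longRun)) := by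
      simp only [hS]; field_simp
    rw [this, Real.exp_log hq]
    field_simp
    ring
  have hcont : ContinuousAt (fun q => B * S q + (1 - Real.exp (-M.r * S q)) * U) b := by
    fun_prop
  rw [Metric.continuousAt_iff']
  intro η hη
  obtain ⟨ξ, hξ, hξv⟩ := M.exists_policy_near_value b
    (lt_min (half_pos hη) M.fixedCost_pos)
  -- An experiment with mean at an endpoint is degenerate, so acquiring at once would lose the fixed
  -- cost; the policy was chosen within less than that of the optimum.
  have hw0 : ξ.wait 0 (fun _ => b) ≠ 0 := by
    intro hw
    have hd : ∀ᵐ q ∂(ξ.exper 0 fun _ => b), q = b := by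
      refine ae_eq_of_integral_eq_endpoint hb ?_
      rw [ξ.bayes 0 _ (by rw [hw]; exact ENNReal.zero_ne_top), hw]
      simp [History.last]
    have h1 : ∀ᵐ ω ∂(ξ.law b), ω 1 = b := by
      have h2 := Policy.law_first_posterior (ξ := ξ) b (measurableSet_singleton b).compl
      rw [ae_iff]
      refine h2.trans ?_
      rw [ae_iff] at hd
      exact hd
    have := Policy.payoff_add_fixedCost_le hw h1 hξ
    linarith [min_le_right (η / 2) M.fixedCost]
  have hτ : ∀ᶠ q in 𝓝 b, ((S q).toNNReal : ℝ≥0∞) ≤ ξ.wait 0 fun _ => b := by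
    have h1 : ContinuousAt (fun q => ((S q).toNNReal : ℝ≥0∞)) b :=
      ENNReal.continuous_coe.continuousAt.comp (continuous_real_toNNReal.continuousAt.comp hSc)
    have h2 : ((S b).toNNReal : ℝ≥0∞) < ξ.wait 0 fun _ => b := by
      rw [hSb]; simpa using pos_iff_ne_zero.2 hw0
    filter_upwards [h1.eventually (gt_mem_nhds h2)] with q hq using hq.le
  have hsmall : ∀ᶠ q in 𝓝 b, B * S q + (1 - Real.exp (-M.r * S q)) * U < η / 2 := by
    refine hcont.eventually (gt_mem_nhds ?_)
    dsimp only
    rw [hSb]; simpa using hη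
  filter_upwards [hdrift, hτ, hsmall] with q ⟨hS0, hq⟩ hqτ hqs
  have h1 := M.exp_mul_value_drift_le b (S q).toNNReal
  have h2 := M.payoff_sub_le_exp_mul_value_drift ξ hξ hqτ
  rw [hq, Real.coe_toNNReal _ hS0] at h1 h2
  have hE : Real.exp (-M.r * S q) ≤ 1 := by
    rw [Real.exp_le_one_iff]; nlinarith
  have h3 : |M.value q - Real.exp (-M.r * S q) * M.value q| ≤ (1 - Real.exp (-M.r * S q)) * U := by
    have : M.value q - Real.exp (-M.r * S q) * M.value q =
      (1 - Real.exp (-M.r * S q)) * M.value q := by ring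
    rw [this, abs_mul, abs_of_nonneg (by linarith)]
    exact mul_le_mul_of_nonneg_left (M.abs_value_le q) (by linarith)
  rw [abs_le] at h3
  rw [Real.dist_eq, abs_lt]
  have := min_le_left (η / 2) M.fixedCost
  constructor <;> linarith [h3.1, h3.2]

theorem continuous_value : Continuous M.value := by
  rw [continuous_iff_continuousAt]
  intro p
  by_cases h0 : (p : ℝ) = 0
  · exact M.continuousAt_value_endpoint (Or.inl h0)
  by_cases h1 : (p : ℝ) = 1
  · exact M.continuousAt_value_endpoint (Or.inr h1)
  exact M.continuousAt_value_of_mem_Ioo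
    ⟨lt_of_le_of_ne p.2.1 (Ne.symm h0), lt_of_le_of_ne p.2.2 h1⟩

end Model

/-! ### The concave envelope and the topology of the two regions. -/

namespace Model

variable (M : Model)

theorem Ioo_subset_domain : Set.Ioo 0 1 ⊆ M.domain := fun x hx =>
  ⟨Set.Ioo_subset_Icc_self hx, M.c_finite x hx⟩

theorem convexOn_c : ConvexOn ℝ M.domain fun x => (M.c x).toReal := by
  have key : ∀ x ∈ M.domain, ∀ y ∈ M.domain, ∀ a b : ℝ, 0 ≤ a → 0 ≤ b → a + b = 1 →
      ENNReal.ofReal a * M.c x + ENNReal.ofReal b * M.c y ≠ ⊤ := fun x hx y hy a b _ _ _ =>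
    ENNReal.add_ne_top.2 ⟨ENNReal.mul_ne_top ENNReal.ofReal_ne_top hx.2,
      ENNReal.mul_ne_top ENNReal.ofReal_ne_top hy.2⟩
  refine ⟨fun x hx y hy a b ha hb hab => ⟨convex_Icc 0 1 hx.1 hy.1 ha hb hab, ?_⟩,
    fun x hx y hy a b ha hb hab => ?_⟩
  · exact ne_top_of_le_ne_top (key x hx y hy a b ha hb hab)
      (M.c_convex x hx.1 y hy.1 a b ha hb hab)
  · have := ENNReal.toReal_mono (key x hx y hy a b ha hb hab)
      (M.c_convex x hx.1 y hy.1 a b ha hb hab)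
    rwa [ENNReal.toReal_add (ENNReal.mul_ne_top ENNReal.ofReal_ne_top hx.2)
      (ENNReal.mul_ne_top ENNReal.ofReal_ne_top hy.2), ENNReal.toReal_mul, ENNReal.toReal_mul,
      ENNReal.toReal_ofReal ha, ENNReal.toReal_ofReal hb] at this

theorem concaveEnvelope_le {g : ℝ → ℝ} (hg : ConcaveOn ℝ M.domain g)
    (h : ∀ q : Belief, (q : ℝ) ∈ M.domain → M.netValue q ≤ g q) {p : Belief}
    (hp : (p : ℝ) ∈ M.domain) : concaveEnvelope M.domain M.netValue p ≤ g p := by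
  -- All majorants lie above the net value at `p`, so the infimum is over a set bounded below.
  refine csInf_le ⟨M.netValue p, ?_⟩ ⟨g, hg, h, rfl⟩
  rintro y ⟨g', -, h', rfl⟩
  exact h' p hp

theorem netValue_le (q : Belief) : M.netValue q ≤ M.utilityBound / M.r := by
  have := (abs_le.1 (M.abs_value_le q)).2
  have : 0 ≤ (M.c q).toReal := ENNReal.toReal_nonneg
  unfold netValue
  linarith

theorem le_concaveEnvelope {p : Belief} {z : ℝ}
    (h : ∀ g : ℝ → ℝ, ConcaveOn ℝ M.domain g →
      (∀ q : Belief, (q : ℝ) ∈ M.domain → M.netValue q ≤ g q) → z ≤ g p) :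
    z ≤ concaveEnvelope M.domain M.netValue p := by
  refine le_csInf ?_ ?_
  · exact ⟨M.utilityBound / M.r, fun _ => M.utilityBound / M.r,
      concaveOn_const _ M.convexOn_c.1, fun q _ => M.netValue_le q, rfl⟩
  · rintro y ⟨g, hg, h', rfl⟩
    exact h g hg h'

/-- An infimum of concave functions is concave; `projIcc` only extends the envelope to the reals, so
that concave functions' interior continuity applies. -/
theorem concaveOn_concaveEnvelope : ConcaveOn ℝ M.domain fun x =>
    concaveEnvelope M.domain M.netValue (Set.projIcc 0 1 zero_le_one x) := by
  refine ⟨M.convexOn_c.1, fun x hx y hy a b ha hb hab => ?_⟩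
  have hz := M.convexOn_c.1 hx hy ha hb hab
  dsimp only
  rw [Set.projIcc_of_mem zero_le_one hx.1, Set.projIcc_of_mem zero_le_one hy.1,
    Set.projIcc_of_mem zero_le_one hz.1]
  refine M.le_concaveEnvelope fun g hg h => ?_
  refine le_trans ?_ (hg.2 hx hy ha hb hab)
  have h1 := M.concaveEnvelope_le hg h (p := ⟨x, hx.1⟩) hx
  have h2 := M.concaveEnvelope_le hg h (p := ⟨y, hy.1⟩) hy
  exact add_le_add (mul_le_mul_of_nonneg_left h1 ha) (mul_le_mul_of_nonneg_left h2 hb)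

theorem continuousAt_residual {p : Belief} (hp : (p : ℝ) ∈ Set.Ioo 0 1) :
    ContinuousAt M.residual p := by
  have hI : Set.Ioo (0 : ℝ) 1 ∈ 𝓝 (p : ℝ) := isOpen_Ioo.mem_nhds hp
  have h1 : ContinuousAt (fun q : Belief => concaveEnvelope M.domain M.netValue q) p := by
    have h2 := M.concaveOn_concaveEnvelope.continuousOn_interior.continuousAt (x := (p : ℝ))
      (mem_of_superset hI (interior_maximal M.Ioo_subset_domain isOpen_Ioo))
    have h3 : ContinuousAt (fun q : Belief => (q : ℝ)) p := continuous_subtype_val.continuousAt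
    have h4 := ContinuousAt.comp (f := fun q : Belief => (q : ℝ)) (x := p) h2 h3
    have e : ((fun x => concaveEnvelope M.domain M.netValue (Set.projIcc 0 1 zero_le_one x)) ∘
        fun q : Belief => (q : ℝ)) = fun q => concaveEnvelope M.domain M.netValue q := by
      funext q
      simp only [Function.comp, Set.projIcc_val]
    rwa [e] at h4
  have h2 : ContinuousAt (fun q : Belief => (M.c q).toReal) p :=
    ContinuousAt.comp (f := fun q : Belief => (q : ℝ)) (x := p)
      (M.c_smooth.continuousOn.continuousAt hI) continuous_subtype_val.continuousAt
  exact h1.sub (M.continuous_value.continuousAt.sub h2)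

/-- Continuity of `v` at `b` puts `v` below a steep cone with apex `v b + η`. On `[0, 1]` the cone
is affine, so cone minus `c` is a concave majorant of the net value; in the residual `c` cancels, so
its behaviour at the endpoint does not matter. -/
theorem exists_residual_le {b : Belief} (hb : (b : ℝ) = 0 ∨ (b : ℝ) = 1) {η : ℝ} (hη : 0 < η) :
    ∃ K : ℝ, ∀ p : Belief, (p : ℝ) ∈ M.domain →
      M.residual p ≤ M.value b + η + K * |(p : ℝ) - b| - M.value p := by
  have hU : 0 ≤ M.utilityBound / M.r := div_nonneg M.utilityBound_nonneg M.r_pos.le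
  obtain ⟨δ, hδ, hcont⟩ := Metric.continuousAt_iff.1 (M.continuous_value.continuousAt (x := b)) η hη
  -- Beyond distance `δ` the cone has risen by twice the bound on `|v|`, the largest possible
  -- difference of two values.
  set K := 2 * (M.utilityBound / M.r) / δ with hK
  have hK0 : 0 ≤ K := by positivity
  have hmaj : ∀ q : Belief, M.value q ≤ M.value b + η + K * |(q : ℝ) - b| := by
    intro q
    by_cases hq : |(q : ℝ) - b| < δ
    · have := hcont (x := q) (by rwa [Subtype.dist_eq, Real.dist_eq])
      rw [Real.dist_eq, abs_lt] at this
      have h2 := mul_nonneg hK0 (abs_nonneg ((q : ℝ) - b))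
      linarith
    · have h1 : 2 * (M.utilityBound / M.r) ≤ K * |(q : ℝ) - b| := by
        rw [hK, div_mul_eq_mul_div, le_div_iff₀ hδ]
        exact mul_le_mul_of_nonneg_left (not_lt.1 hq) (by positivity)
      have := (abs_le.1 (M.abs_value_le q)).2
      have := (abs_le.1 (M.abs_value_le b)).1
      linarith
  -- Only at an endpoint is the distance affine on the whole interval.
  obtain ⟨σ, hσ⟩ : ∃ σ : ℝ, ∀ x ∈ Set.Icc (0 : ℝ) 1, |x - b| = σ * (x - b) := by
    rcases hb with h | h
    · refine ⟨1, fun x hx => ?_⟩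
      rw [h, abs_of_nonneg (by linarith [hx.1])]; ring
    · refine ⟨-1, fun x hx => ?_⟩
      rw [h, abs_of_nonpos (by linarith [hx.2])]; ring
  refine ⟨K, fun p hp => ?_⟩
  have hconc : ConcaveOn ℝ M.domain fun x =>
      M.value b + η + K * (σ * (x - b)) - (M.c x).toReal := by
    refine ⟨M.convexOn_c.1, fun x hx y hy s t hs ht hst => ?_⟩
    have := M.convexOn_c.2 hx hy hs ht hst
    simp only [smul_eq_mul] at this ⊢
    obtain rfl : t = 1 - s := by linarith
    nlinarith
  have h := M.concaveEnvelope_le hconc (fun q hq => by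
    have := hmaj q
    rw [hσ q q.2] at this
    unfold netValue; linarith) hp
  rw [← hσ p p.2] at h
  unfold residual netValue
  unfold netValue at h
  linarith

theorem endpoint_notMem_grossRegion {b : Belief} (hb : (b : ℝ) = 0 ∨ (b : ℝ) = 1) :
    b ∉ M.grossRegion := by
  rintro ⟨hd, hpos⟩
  obtain ⟨K, hK⟩ := M.exists_residual_le hb (half_pos hpos)
  have := hK b hd
  simp only [sub_self, abs_zero, mul_zero, add_zero] at this
  linarith

theorem eventually_notMem_acqRegion {b : Belief} (hb : (b : ℝ) = 0 ∨ (b : ℝ) = 1) :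
    ∀ᶠ q in 𝓝 b, q ∉ M.acqRegion := by
  obtain ⟨K, hK⟩ := M.exists_residual_le hb (half_pos M.fixedCost_pos)
  have hc : Continuous fun p : Belief =>
      M.value b + M.fixedCost / 2 + K * |(p : ℝ) - b| - M.value p := by
    have := M.continuous_value
    fun_prop
  have hlt : M.value b + M.fixedCost / 2 + K * |(b : ℝ) - b| - M.value b < M.fixedCost := by
    simp only [sub_self, abs_zero, mul_zero]; linarith [M.fixedCost_pos]
  have := hc.continuousAt.eventually (gt_mem_nhds hlt)
  filter_upwards [this] with q hq hqI
  have := hK q hqI.1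
  rw [hqI.2] at this
  linarith

theorem acqRegion_subset_grossRegion : M.acqRegion ⊆ M.grossRegion := fun _ hp =>
  ⟨hp.1, by rw [hp.2]; exact M.fixedCost_pos⟩

theorem mem_Ioo_of_mem_grossRegion {p : Belief} (hp : p ∈ M.grossRegion) :
    (p : ℝ) ∈ Set.Ioo 0 1 := by
  refine ⟨lt_of_le_of_ne p.2.1 fun h => ?_, lt_of_le_of_ne p.2.2 fun h => ?_⟩
  · exact M.endpoint_notMem_grossRegion (Or.inl h.symm) hp
  · exact M.endpoint_notMem_grossRegion (Or.inr h) hp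

theorem isOpen_grossRegion : IsOpen M.grossRegion := by
  rw [isOpen_iff_mem_nhds]
  intro p hp
  have hI := M.mem_Ioo_of_mem_grossRegion hp
  have h1 : ∀ᶠ q : Belief in 𝓝 p, (q : ℝ) ∈ Set.Ioo 0 1 :=
    continuous_subtype_val.continuousAt.eventually (isOpen_Ioo.mem_nhds hI)
  filter_upwards [h1, (M.continuousAt_residual hI).eventually (lt_mem_nhds hp.2)] with q h2 h3
  exact ⟨M.Ioo_subset_domain h2, h3⟩

/-- Continuity of the residual settles interior beliefs. At the endpoints it may fail, but there
`eventually_notMem_acqRegion` keeps the residual below the fixed cost nearby. -/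
theorem isClosed_acqRegion : IsClosed M.acqRegion := by
  rw [← isOpen_compl_iff, isOpen_iff_mem_nhds]
  intro p hp
  by_cases h0 : (p : ℝ) = 0
  · exact M.eventually_notMem_acqRegion (Or.inl h0)
  by_cases h1 : (p : ℝ) = 1
  · exact M.eventually_notMem_acqRegion (Or.inr h1)
  have hI : (p : ℝ) ∈ Set.Ioo 0 1 :=
    ⟨lt_of_le_of_ne p.2.1 (Ne.symm h0), lt_of_le_of_ne p.2.2 h1⟩
  have hne : M.residual p ≠ M.fixedCost := fun h => hp ⟨M.Ioo_subset_domain hI, h⟩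
  filter_upwards [(M.continuousAt_residual hI).eventually_ne hne] with q hq hqI
  exact hq hqI.2

end Model

/-! ### Weights of binary experiments. -/

namespace IsBinaryExperiment

variable {F : Measure Belief} {a b x : Belief}

theorem ae_eq_or_eq (h : IsBinaryExperiment F a b x) : ∀ᵐ q ∂F, q = a ∨ q = b := by
  rw [ae_iff]
  exact h.2.1

/-- Integrating `b - q` against `F` eliminates the mass at `b`. -/
theorem real_left (h : IsBinaryExperiment F a b x) (hab : a < b) :
    ((b : ℝ) - a) * F.real {a} = b - x := by
  have := h.1
  have h1 : ∫ q : Belief, ((b : ℝ) - q) ∂F = b - x := by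
    rw [integral_sub (integrable_const _) (integrable_coe F), h.2.2]; simp
  have h2 : ∫ q : Belief, ((b : ℝ) - q) ∂F =
      ∫ q : Belief, Set.indicator {a} (fun _ => (b : ℝ) - a) q ∂F := by
    refine integral_congr_ae ?_
    filter_upwards [h.ae_eq_or_eq] with q hq
    rcases hq with rfl | rfl
    · simp
    · simp [Set.indicator, hab.ne']
  rw [integral_indicator_const _ (measurableSet_singleton a)] at h2
  rw [← h1, h2, smul_eq_mul, mul_comm]

theorem real_right (h : IsBinaryExperiment F a b x) (hab : a < b) :
    ((b : ℝ) - a) * F.real {b} = x - a := by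
  have := h.1
  have h1 : ∫ q : Belief, ((q : ℝ) - a) ∂F = x - a := by
    rw [integral_sub (integrable_coe F) (integrable_const _), h.2.2]; simp
  have h2 : ∫ q : Belief, ((q : ℝ) - a) ∂F =
      ∫ q : Belief, Set.indicator {b} (fun _ => (b : ℝ) - a) q ∂F := by
    refine integral_congr_ae ?_
    filter_upwards [h.ae_eq_or_eq] with q hq
    rcases hq with rfl | rfl
    · simp [Set.indicator, hab.ne]
    · simp
  rw [integral_indicator_const _ (measurableSet_singleton b)] at h2
  rw [← h1, h2, smul_eq_mul, mul_comm]

/-- The support and the mean determine the weights, both below one as the mean is strictly inside.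
Hence `θ` can be chosen before `F`, uniformly over histories. -/
theorem exists_measure_singleton_le (hax : a < x) (hxb : x < b) (e : Belief) :
    ∃ θ : ℝ≥0∞, θ < 1 ∧ ∀ F, IsBinaryExperiment F a b x → F {e} ≤ θ := by
  have hab := hax.trans hxb
  have hax' : (a : ℝ) < x := hax
  have hxb' : (x : ℝ) < b := hxb
  by_cases hea : e = a
  · refine ⟨ENNReal.ofReal (((b : ℝ) - x) / (b - a)), ?_, fun F h => ?_⟩
    · rw [ENNReal.ofReal_lt_one, div_lt_one (by linarith)]; linarith
    · have := h.1
      have h1 := h.real_left hab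
      rw [hea, ← ofReal_measureReal]
      refine ENNReal.ofReal_le_ofReal (le_of_eq ?_)
      rw [eq_div_iff (by linarith), ← h1, mul_comm]
  by_cases heb : e = b
  · refine ⟨ENNReal.ofReal (((x : ℝ) - a) / (b - a)), ?_, fun F h => ?_⟩
    · rw [ENNReal.ofReal_lt_one, div_lt_one (by linarith)]; linarith
    · have := h.1
      have h1 := h.real_right hab
      rw [heb, ← ofReal_measureReal]
      refine ENNReal.ofReal_le_ofReal (le_of_eq ?_)
      rw [eq_div_iff (by linarith), ← h1, mul_comm]
  · refine ⟨0, zero_lt_one, fun F h => ?_⟩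
    rw [← h.2.1]
    exact measure_mono (by rintro q rfl; simp [hea, heb])

end IsBinaryExperiment

/-! ### Components, hitting times and existence of the optimal policy. -/

namespace Model

variable (M : Model)

theorem exists_isGreatest_left (x : Belief) :
    ∃ a, IsGreatest {y : Belief | y ≤ x ∧ y ∉ M.grossRegion} a := by
  have hc : IsClosed {y : Belief | y ≤ x ∧ y ∉ M.grossRegion} :=
    isClosed_Iic.inter M.isOpen_grossRegion.isClosed_compl
  exact hc.isCompact.exists_isGreatest
    ⟨⟨0, by simp⟩, Subtype.coe_le_coe.1 x.2.1, M.endpoint_notMem_grossRegion (Or.inl rfl)⟩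

theorem exists_isLeast_right (x : Belief) :
    ∃ b, IsLeast {y : Belief | x ≤ y ∧ y ∉ M.grossRegion} b := by
  have hc : IsClosed {y : Belief | x ≤ y ∧ y ∉ M.grossRegion} :=
    isClosed_Ici.inter M.isOpen_grossRegion.isClosed_compl
  exact hc.isCompact.exists_isLeast
    ⟨⟨1, by simp⟩, Subtype.coe_le_coe.1 x.2.2, M.endpoint_notMem_grossRegion (Or.inr rfl)⟩

/-- The closest belief below `x` without positive residual value of information. -/
def leftEnd (x : Belief) : Belief := (M.exists_isGreatest_left x).choose

/-- The closest belief above `x` without positive residual value of information. -/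
def rightEnd (x : Belief) : Belief := (M.exists_isLeast_right x).choose

theorem isGreatest_leftEnd (x : Belief) :
    IsGreatest {y : Belief | y ≤ x ∧ y ∉ M.grossRegion} (M.leftEnd x) :=
  (M.exists_isGreatest_left x).choose_spec

theorem isLeast_rightEnd (x : Belief) :
    IsLeast {y : Belief | x ≤ y ∧ y ∉ M.grossRegion} (M.rightEnd x) :=
  (M.exists_isLeast_right x).choose_spec

theorem leftEnd_le (x : Belief) : M.leftEnd x ≤ x := (M.isGreatest_leftEnd x).1.1

theorem le_rightEnd (x : Belief) : x ≤ M.rightEnd x := (M.isLeast_rightEnd x).1.1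

theorem leftEnd_notMem (x : Belief) : M.leftEnd x ∉ M.grossRegion := (M.isGreatest_leftEnd x).1.2

theorem rightEnd_notMem (x : Belief) : M.rightEnd x ∉ M.grossRegion := (M.isLeast_rightEnd x).1.2

theorem le_leftEnd {x y : Belief} (h : y ≤ x) (hy : y ∉ M.grossRegion) : y ≤ M.leftEnd x :=
  (M.isGreatest_leftEnd x).2 ⟨h, hy⟩

theorem rightEnd_le {x y : Belief} (h : x ≤ y) (hy : y ∉ M.grossRegion) : M.rightEnd x ≤ y :=
  (M.isLeast_rightEnd x).2 ⟨h, hy⟩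

theorem leftEnd_lt {x : Belief} (hx : x ∈ M.grossRegion) : M.leftEnd x < x :=
  lt_of_le_of_ne (M.leftEnd_le x) fun h => M.leftEnd_notMem x (by rwa [h])

theorem lt_rightEnd {x : Belief} (hx : x ∈ M.grossRegion) : x < M.rightEnd x :=
  lt_of_le_of_ne (M.le_rightEnd x) fun h => M.rightEnd_notMem x (by rwa [← h])

/-- Serves for Borel measurability of the targets. -/
theorem monotone_leftEnd : Monotone M.leftEnd := fun x _ h =>
  M.le_leftEnd ((M.leftEnd_le x).trans h) (M.leftEnd_notMem x)

theorem monotone_rightEnd : Monotone M.rightEnd := fun _ y h =>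
  M.rightEnd_le (h.trans (M.le_rightEnd y)) (M.rightEnd_notMem y)

theorem mem_grossRegion_of_mem_Ioo {x y : Belief}
    (h : y ∈ Set.Ioo (M.leftEnd x) (M.rightEnd x)) : y ∈ M.grossRegion := by
  by_contra hy
  rcases le_total y x with hyx | hxy
  · exact absurd h.1 (not_lt.2 (M.le_leftEnd hyx hy))
  · exact absurd h.2 (not_lt.2 (M.rightEnd_le hxy hy))

theorem leftEnd_eq_of_mem_Ioo {x y : Belief}
    (h : y ∈ Set.Ioo (M.leftEnd x) (M.rightEnd x)) : M.leftEnd y = M.leftEnd x := by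
  refine le_antisymm ?_ (M.le_leftEnd h.1.le (M.leftEnd_notMem x))
  by_contra hlt
  exact M.leftEnd_notMem y (M.mem_grossRegion_of_mem_Ioo
    ⟨not_le.1 hlt, (M.leftEnd_le y).trans_lt h.2⟩)

theorem rightEnd_eq_of_mem_Ioo {x y : Belief}
    (h : y ∈ Set.Ioo (M.leftEnd x) (M.rightEnd x)) : M.rightEnd y = M.rightEnd x := by
  refine le_antisymm (M.rightEnd_le h.2.le (M.rightEnd_notMem x)) ?_
  by_contra hlt
  exact M.rightEnd_notMem y (M.mem_grossRegion_of_mem_Ioo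
    ⟨h.1.trans_le (M.le_rightEnd y), not_le.1 hlt⟩)

theorem mem_Ioo_ends {x : Belief} (hx : x ∈ M.grossRegion) :
    x ∈ Set.Ioo (M.leftEnd x) (M.rightEnd x) := ⟨M.leftEnd_lt hx, M.lt_rightEnd hx⟩

/-- Only finitely many components of the region with positive residual value of information meet
the information acquisition region. -/
theorem finite_ends : (M.leftEnd '' M.acqRegion ∪ M.rightEnd '' M.acqRegion).Finite := by
  have hcomp : CompactSpace M.acqRegion :=
    isCompact_iff_compactSpace.1 M.isClosed_acqRegion.isCompact
  have hnhds : ∀ x : M.acqRegion, ∀ᶠ y : M.acqRegion in 𝓝 x,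
      (y : Belief) ∈ Set.Ioo (M.leftEnd x) (M.rightEnd x) := fun x =>
    continuous_subtype_val.continuousAt.eventually (isOpen_Ioo.mem_nhds
      (M.mem_Ioo_ends (M.acqRegion_subset_grossRegion x.2)))
  -- The ends are constant on each component, hence locally constant on the compact region, hence of
  -- finite range.
  have hl : IsLocallyConstant fun x : M.acqRegion => M.leftEnd x :=
    (IsLocallyConstant.iff_eventually_eq _).2 fun x => (hnhds x).mono fun y hy =>
      M.leftEnd_eq_of_mem_Ioo hy
  have hr : IsLocallyConstant fun x : M.acqRegion => M.rightEnd x :=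
    (IsLocallyConstant.iff_eventually_eq _).2 fun x => (hnhds x).mono fun y hy =>
      M.rightEnd_eq_of_mem_Ioo hy
  refine Set.Finite.union ?_ ?_
  · rw [Set.image_eq_range]; exact hl.range_finite
  · rw [Set.image_eq_range]; exact hr.range_finite

theorem hitTime_le {q : Belief} {t : ℝ≥0} (h : M.drift q t ∈ M.acqRegion) :
    M.hitTime q ≤ t := iInf₂_le t h

theorem continuous_drift_right (q : Belief) : Continuous fun t => M.drift q t :=
  M.continuous_drift.comp (by fun_prop : Continuous fun t : ℝ≥0 => (q, t))

/-- The belief at which the information acquisition region is hit. -/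
def hitPoint (q : Belief) : Belief := M.drift q (M.hitTime q).toNNReal

/-- The set of hitting times is closed, so its infimum is attained. -/
theorem hitPoint_mem {q : Belief} (h : M.hitTime q ≠ ⊤) : M.hitPoint q ∈ M.acqRegion := by
  set T : Set ℝ≥0 := {t | M.drift q t ∈ M.acqRegion} with hT
  have hne : T.Nonempty := by
    by_contra hT0
    rw [Set.not_nonempty_iff_eq_empty] at hT0
    refine h (iInf₂_eq_top.2 fun t ht => ?_)
    have : t ∈ T := ht
    rw [hT0] at this
    exact this.elim
  have hcl : IsClosed T := M.isClosed_acqRegion.preimage (M.continuous_drift_right q)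
  have hs := hcl.csInf_mem hne (OrderBot.bddBelow T)
  have : M.hitTime q = ((sInf T : ℝ≥0) : ℝ≥0∞) := by
    rw [ENNReal.coe_sInf hne]; rfl
  rw [hitPoint, this, ENNReal.toNNReal_coe]
  exact hs

/-- The infimum being attained, a sublevel set is the projection of a compact set of pairs of belief
and time, hence closed. -/
theorem measurable_hitTime : Measurable M.hitTime := by
  refine measurable_of_Iic fun a => ?_
  induction a using ENNReal.recTopCoe with
  | top => simp
  | coe a =>
    have hc : Continuous fun z : Belief × Set.Icc (0 : ℝ≥0) a => (z.1, (z.2 : ℝ≥0)) := by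
      fun_prop
    have hcl : IsClosed {z : Belief × Set.Icc (0 : ℝ≥0) a | M.drift z.1 z.2 ∈ M.acqRegion} :=
      M.isClosed_acqRegion.preimage (M.continuous_drift.comp hc)
    have : M.hitTime ⁻¹' Set.Iic (a : ℝ≥0∞) = Prod.fst ''
        {z : Belief × Set.Icc (0 : ℝ≥0) a | M.drift z.1 z.2 ∈ M.acqRegion} := by
      ext q
      simp only [Set.mem_preimage, Set.mem_Iic, Set.mem_image, Prod.exists,
        exists_and_right, exists_eq_right]
      constructor
      · intro hq
        have hne : M.hitTime q ≠ ⊤ := ne_top_of_le_ne_top ENNReal.coe_ne_top hq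
        refine ⟨⟨(M.hitTime q).toNNReal, zero_le, ?_⟩, M.hitPoint_mem hne⟩
        rw [← ENNReal.coe_le_coe, ENNReal.coe_toNNReal hne]; exact hq
      · rintro ⟨t, ht⟩
        exact (M.hitTime_le ht).trans (ENNReal.coe_le_coe.2 t.2.2)
    rw [this]
    exact (hcl.isCompact.image continuous_fst).isClosed.measurableSet

theorem measurable_hitPoint : Measurable M.hitPoint :=
  M.continuous_drift.measurable.comp (measurable_id.prodMk M.measurable_hitTime.ennreal_toNNReal)

/-- The weight of the lower end in the binary experiment acquired at `x`. -/
def leftWeight (x : Belief) : ℝ :=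
  ((M.rightEnd x : ℝ) - x) / (M.rightEnd x - M.leftEnd x)

theorem leftWeight_mem (x : Belief) : M.leftWeight x ∈ Set.Icc (0 : ℝ) 1 := by
  have h1 : (M.leftEnd x : ℝ) ≤ x := M.leftEnd_le x
  have h2 : (x : ℝ) ≤ M.rightEnd x := M.le_rightEnd x
  exact ⟨div_nonneg (by linarith) (by linarith), div_le_one_of_le₀ (by linarith) (by linarith)⟩

theorem measurable_leftWeight : Measurable M.leftWeight := by
  have h1 : Measurable fun x => (M.leftEnd x : ℝ) :=
    measurable_subtype_coe.comp M.monotone_leftEnd.measurable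
  have h2 : Measurable fun x => (M.rightEnd x : ℝ) :=
    measurable_subtype_coe.comp M.monotone_rightEnd.measurable
  exact (h2.sub measurable_subtype_coe).div (h2.sub h1)

/-- The binary experiment supported on the closest beliefs without positive residual value of
information, as a function of the belief at which it is acquired. -/
def binaryKernel : Kernel Belief Belief where
  toFun x := ENNReal.ofReal (M.leftWeight x) • Measure.dirac (M.leftEnd x) +
    ENNReal.ofReal (1 - M.leftWeight x) • Measure.dirac (M.rightEnd x)
  measurable' := by
    refine Measure.measurable_of_measurable_coe _ fun s hs => ?_
    simp only [Measure.add_apply, Measure.smul_apply, smul_eq_mul, Measure.dirac_apply' _ hs]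
    have hone : Measurable (s.indicator (1 : Belief → ℝ≥0∞)) := measurable_one.indicator hs
    exact (M.measurable_leftWeight.ennreal_ofReal.mul
      (hone.comp M.monotone_leftEnd.measurable)).add
      ((measurable_const.sub M.measurable_leftWeight).ennreal_ofReal.mul
      (hone.comp M.monotone_rightEnd.measurable))

theorem binaryKernel_apply (x : Belief) : M.binaryKernel x =
    ENNReal.ofReal (M.leftWeight x) • Measure.dirac (M.leftEnd x) +
    ENNReal.ofReal (1 - M.leftWeight x) • Measure.dirac (M.rightEnd x) := rfl

instance : IsMarkovKernel M.binaryKernel := ⟨fun x => ⟨by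
  have h := M.leftWeight_mem x
  rw [binaryKernel_apply]
  simp only [Measure.add_apply, Measure.smul_apply, measure_univ, smul_eq_mul, mul_one]
  rw [← ENNReal.ofReal_add h.1 (sub_nonneg.2 h.2)]
  simp⟩⟩

theorem isBinaryExperiment_binaryKernel (x : Belief) :
    IsBinaryExperiment (M.binaryKernel x) (M.leftEnd x) (M.rightEnd x) x := by
  have hw := M.leftWeight_mem x
  refine ⟨inferInstance, ?_, ?_⟩
  · rw [binaryKernel_apply]
    simp
  · have hi : ∀ y : Belief, Integrable (fun q : Belief => (q : ℝ)) (Measure.dirac y) :=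
      fun y => integrable_dirac (by simp)
    rw [binaryKernel_apply, integral_add_measure ((hi _).smul_measure ENNReal.ofReal_ne_top)
      ((hi _).smul_measure ENNReal.ofReal_ne_top), integral_smul_measure, integral_smul_measure,
      integral_dirac, integral_dirac, ENNReal.toReal_ofReal hw.1,
      ENNReal.toReal_ofReal (sub_nonneg.2 hw.2)]
    have h1 : (M.leftEnd x : ℝ) ≤ x := M.leftEnd_le x
    have h2 : (x : ℝ) ≤ M.rightEnd x := M.le_rightEnd x
    simp only [smul_eq_mul, leftWeight]
    -- If the ends coincide, both equal `x`; the weight `0 / 0 = 0` then puts all mass on `x`.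
    rcases eq_or_lt_of_le (h1.trans h2) with h | h
    · rw [h, sub_self, div_zero]; linarith
    · have : (M.rightEnd x : ℝ) - M.leftEnd x ≠ 0 := by linarith
      field_simp
      ring

/-- The optimal policy. -/
def optimalPolicy : Policy M where
  wait _ h := M.hitTime h.last
  measurable_wait _ := M.measurable_hitTime.comp History.measurable_last
  exper _ := Kernel.comap M.binaryKernel (fun h => M.hitPoint h.last)
    (M.measurable_hitPoint.comp History.measurable_last)
  markov _ := Kernel.IsMarkovKernel.comap _ _
  bayes _ h _ := (M.isBinaryExperiment_binaryKernel (M.hitPoint h.last)).2.2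

theorem isOptimalRule_optimalPolicy : M.optimalPolicy.IsOptimalRule := fun _ h =>
  ⟨rfl, fun _ => ⟨M.leftEnd (M.hitPoint h.last), M.rightEnd (M.hitPoint h.last),
    M.isGreatest_leftEnd _, M.isLeast_rightEnd _, M.isBinaryExperiment_binaryKernel _⟩⟩

end Model

/-! ### The random sequence of posteriors under the optimal rule. -/

namespace Policy

variable {M : Model} {ξ : Policy M}

theorem IsOptimalRule.wait_eq (hξ : ξ.IsOptimalRule) {n : ℕ} (h : History n) :
    ξ.wait n h = M.hitTime h.last := (hξ n h).1

theorem IsOptimalRule.isBinaryExperiment (hξ : ξ.IsOptimalRule) {n : ℕ} {h : History n}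
    (hh : M.hitTime h.last ≠ ⊤) :
    IsBinaryExperiment (ξ.exper n h) (M.leftEnd (M.hitPoint h.last))
      (M.rightEnd (M.hitPoint h.last)) (M.hitPoint h.last) := by
  obtain ⟨hw, h2⟩ := hξ n h
  obtain ⟨a, b, ha, hb, hab⟩ := h2 (by rwa [hw])
  rw [hw] at ha hb hab
  rw [(M.isGreatest_leftEnd (M.hitPoint h.last)).unique ha,
    (M.isLeast_rightEnd (M.hitPoint h.last)).unique hb]
  exact hab

theorem IsOptimalRule.ae_step (hξ : ξ.IsOptimalRule) (p : Belief) :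
    ∀ᵐ ω ∂(ξ.law p), ∀ n, M.hitTime (ω n) ≠ ⊤ →
      ω (n + 1) = M.leftEnd (M.hitPoint (ω n)) ∨ ω (n + 1) = M.rightEnd (M.hitPoint (ω n)) := by
  rw [ae_all_iff]
  intro n
  have hx : Measurable fun z : History n × Belief => M.hitPoint z.1.last :=
    M.measurable_hitPoint.comp (History.measurable_last.comp measurable_fst)
  have hS : MeasurableSet {z : History n × Belief | M.hitTime z.1.last ≠ ⊤ →
      z.2 = M.leftEnd (M.hitPoint z.1.last) ∨ z.2 = M.rightEnd (M.hitPoint z.1.last)} := by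
    have h1 : MeasurableSet {z : History n × Belief | M.hitTime z.1.last = ⊤} :=
      (M.measurable_hitTime.comp (History.measurable_last.comp measurable_fst))
        (measurableSet_singleton ⊤)
    have h2 : MeasurableSet {z : History n × Belief | z.2 = M.leftEnd (M.hitPoint z.1.last)} :=
      measurableSet_eq_fun measurable_snd (M.monotone_leftEnd.measurable.comp hx)
    have h3 : MeasurableSet {z : History n × Belief | z.2 = M.rightEnd (M.hitPoint z.1.last)} :=
      measurableSet_eq_fun measurable_snd (M.monotone_rightEnd.measurable.comp hx)
    convert h1.union (h2.union h3) using 1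
    ext z
    simp only [Set.mem_ofPred_eq, Set.mem_union]
    tauto
  refine ξ.law_ae_step p n hS fun y => ?_
  by_cases hy : M.hitTime y.last = ⊤
  · exact ae_of_all _ fun q h => absurd hy h
  · filter_upwards [(hξ.isBinaryExperiment hy).ae_eq_or_eq] with q hq _ using hq

/-- Where a state is kept with probability bounded away from one, the belief sequence is not
eventually constant at that state. -/
theorem ae_not_eventually_eq (ξ : Policy M) (p e : Belief) {θ : ℝ≥0∞} (hθ : θ < 1)
    (h : ∀ n (y : History n), y.last = e → ξ.exper n y {e} ≤ θ) :
    ∀ᵐ ω ∂(ξ.law p), ¬∃ N, ∀ n, N ≤ n → ω n = e := by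
  simp only [not_exists]
  rw [ae_all_iff]
  intro N
  have hA : ∀ k, MeasurableSet {y : History (N + k) | ∀ i : Finset.Iic (N + k),
      N ≤ i → y i = e} := by
    intro k
    simp only [Set.ofPred_forall]
    exact MeasurableSet.iInter fun i => MeasurableSet.iInter fun _ =>
      History.measurable_apply i (measurableSet_singleton e)
  -- Remaining at `e` from index `N` through `N + k` takes `k` transitions, each of conditional
  -- probability at most `θ`.
  have hbound : ∀ k, (ξ.law p) {ω | hist ω (N + k) ∈ {y : History (N + k) |
      ∀ i : Finset.Iic (N + k), N ≤ i → y i = e}} ≤ θ ^ k := by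
    intro k
    induction k with
    | zero => simpa using prob_le_one
    | succ k ih =>
      have hstep := (ξ.isLaw_law p).step (N + k) _ {e} (hA k) (measurableSet_singleton e)
      refine (measure_mono ?_).trans (hstep.trans_le ?_)
      · intro ω hω
        refine ⟨fun i hi => hω ⟨i, ?_⟩ hi, hω ⟨N + k + 1, ?_⟩ ?_⟩
        · have := Finset.mem_Iic.1 i.2
          exact Finset.mem_Iic.2 (by omega)
        · exact Finset.mem_Iic.2 (by omega)
        · simp only; omega
      · have hle : ∫⁻ ω in {ω | hist ω (N + k) ∈ {y : History (N + k) |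
            ∀ i : Finset.Iic (N + k), N ≤ i → y i = e}}, ξ.exper (N + k) (hist ω (N + k)) {e}
            ∂(ξ.law p) ≤ ∫⁻ ω in {ω | hist ω (N + k) ∈ {y : History (N + k) |
            ∀ i : Finset.Iic (N + k), N ≤ i → y i = e}}, θ ∂(ξ.law p) := by
          refine setLIntegral_mono' (measurable_hist _ (hA k)) fun ω hω => h _ _ ?_
          exact hω ⟨N + k, Finset.mem_Iic.2 le_rfl⟩ (by simp)
        refine hle.trans ?_
        rw [lintegral_const, Measure.restrict_apply MeasurableSet.univ, Set.univ_inter, pow_succ,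
          mul_comm]
        exact mul_le_mul_left ih θ
  rw [ae_iff]
  refine le_antisymm ?_ zero_le
  refine ge_of_tendsto' (ENNReal.tendsto_pow_atTop_nhds_zero_of_lt_one hθ) fun k => ?_
  refine (measure_mono ?_).trans (hbound k)
  intro ω hω i hi
  exact (not_not.1 hω) i hi

/-- The hit point lies strictly between its ends and depends on the history only through `e`, so one
bound below one works for all visits. -/
theorem IsOptimalRule.ae_not_eventually_eq (hξ : ξ.IsOptimalRule) (p : Belief) {e : Belief}
    (he : M.hitTime e ≠ ⊤) : ∀ᵐ ω ∂(ξ.law p), ¬∃ N, ∀ n, N ≤ n → ω n = e := by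
  have hx := M.mem_Ioo_ends (M.acqRegion_subset_grossRegion (M.hitPoint_mem he))
  obtain ⟨θ, hθ, h⟩ := IsBinaryExperiment.exists_measure_singleton_le hx.1 hx.2 e
  refine ξ.ae_not_eventually_eq p e hθ fun n y hy => h _ ?_
  have := hξ.isBinaryExperiment (h := y) (by rwa [hy])
  rwa [hy] at this

end Policy

/-! ### Deterministic dynamics around the long-run belief. -/

namespace Model

variable (M : Model)

/-- The long-run belief. -/
def longRunBelief : Belief := ⟨M.longRun, M.longRun_mem⟩

theorem drift_sub_longRun (q : Belief) (t : ℝ≥0) :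
    (M.drift q t : ℝ) - M.longRun = Real.exp (-M.rate * t) * (q - M.longRun) := by
  rw [coe_drift]; ring

theorem drift_eq_longRunBelief {q : Belief} {t : ℝ≥0} (h : M.drift q t = M.longRunBelief) :
    q = M.longRunBelief := by
  have h1 := M.drift_sub_longRun q t
  rw [h] at h1
  simp only [longRunBelief, sub_self] at h1
  apply Subtype.ext
  simp only [longRunBelief]
  rcases mul_eq_zero.1 h1.symm with h2 | h2
  · exact absurd h2 (Real.exp_pos _).ne'
  · linarith

theorem drift_mem_of_le {q : Belief} (hq : q ≤ M.longRunBelief) (t : ℝ≥0) :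
    q ≤ M.drift q t ∧ M.drift q t ≤ M.longRunBelief := by
  have hq : (q : ℝ) ≤ M.longRun := hq
  have h := M.drift_mem_Icc (α := q) hq le_rfl (q := q) ⟨le_rfl, hq⟩ t
  exact h

theorem drift_mem_of_ge {q : Belief} (hq : M.longRunBelief ≤ q) (t : ℝ≥0) :
    M.longRunBelief ≤ M.drift q t ∧ M.drift q t ≤ q := by
  have hq : M.longRun ≤ (q : ℝ) := hq
  have h := M.drift_mem_Icc (β := q) le_rfl hq (q := q) ⟨hq, le_rfl⟩ t
  exact h

theorem exists_drift_eq {q z : Belief} (h0 : 0 < ((z : ℝ) - M.longRun) / (q - M.longRun))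
    (h1 : ((z : ℝ) - M.longRun) / (q - M.longRun) ≤ 1) : ∃ t, M.drift q t = z := by
  have hq : (q : ℝ) - M.longRun ≠ 0 := by
    intro hq; rw [hq, div_zero] at h0; exact lt_irrefl _ h0
  have hrate := M.rate_pos
  have hs : 0 ≤ -Real.log (((z : ℝ) - M.longRun) / (q - M.longRun)) / M.rate :=
    div_nonneg (neg_nonneg.2 (Real.log_nonpos h0.le h1)) hrate.le
  refine ⟨(-Real.log (((z : ℝ) - M.longRun) / (q - M.longRun)) / M.rate).toNNReal,
    Subtype.ext ?_⟩
  rw [coe_drift, Real.coe_toNNReal _ hs]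
  have : -M.rate * (-Real.log (((z : ℝ) - M.longRun) / (q - M.longRun)) / M.rate) =
      Real.log (((z : ℝ) - M.longRun) / (q - M.longRun)) := by field_simp
  rw [this, Real.exp_log h0]
  field_simp
  ring

theorem exists_drift_eq_of_le {q z : Belief} (hqz : q ≤ z) (hz : z < M.longRunBelief) :
    ∃ t, M.drift q t = z := by
  have h1 : (q : ℝ) ≤ z := hqz
  have h2 : (z : ℝ) < M.longRun := hz
  refine M.exists_drift_eq (div_pos_of_neg_of_neg (by linarith) (by linarith)) ?_
  rw [div_le_one_of_neg (by linarith)]; linarith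

theorem exists_drift_eq_of_ge {q z : Belief} (hzq : z ≤ q) (hz : M.longRunBelief < z) :
    ∃ t, M.drift q t = z := by
  have h1 : (z : ℝ) ≤ q := hzq
  have h2 : M.longRun < (z : ℝ) := hz
  refine M.exists_drift_eq (div_pos (by linarith) (by linarith)) ?_
  rw [div_le_one (by linarith)]; linarith

theorem hitTime_ne_top_of_drift {q : Belief} {t : ℝ≥0} (h : M.hitTime (M.drift q t) ≠ ⊤) :
    M.hitTime q ≠ ⊤ := by
  have h1 := M.hitPoint_mem h
  rw [hitPoint, ← drift_add] at h1
  exact ne_top_of_le_ne_top ENNReal.coe_ne_top (M.hitTime_le h1)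

theorem tendsto_drift (q : Belief) :
    Tendsto (fun t : ℝ≥0 => (M.drift q t : ℝ)) atTop (𝓝 M.longRun) := by
  have h1 : Tendsto (fun t : ℝ≥0 => Real.exp (-M.rate * t)) atTop (𝓝 0) := by
    refine Real.tendsto_exp_atBot.comp ?_
    exact (NNReal.tendsto_coe_atTop.2 tendsto_id).const_mul_atTop_of_neg
      (neg_neg_of_pos M.rate_pos)
  have h2 := (h1.mul_const ((q : ℝ) - M.longRun)).const_add M.longRun
  simpa [coe_drift] using h2

/-- The component of the region with positive residual value of information around the long-run
belief exists, and its ends lead back to the information acquisition region. -/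
def HasCycle : Prop := M.longRunBelief ∈ M.grossRegion ∧
  M.hitTime (M.leftEnd M.longRunBelief) ≠ ⊤ ∧ M.hitTime (M.rightEnd M.longRunBelief) ≠ ⊤

variable {M}

/-- A belief outside `G` is not inside the component of the long-run belief, so its drift passes
through the end on its side, from which the region is hit. -/
theorem HasCycle.hitTime_ne_top (h : M.HasCycle) {z : Belief} (hz : z ∉ M.grossRegion) :
    M.hitTime z ≠ ⊤ := by
  rcases le_total z M.longRunBelief with hle | hle
  · obtain ⟨t, ht⟩ := M.exists_drift_eq_of_le (M.le_leftEnd hle hz) (M.leftEnd_lt h.1)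
    exact M.hitTime_ne_top_of_drift (t := t) (by rw [ht]; exact h.2.1)
  · obtain ⟨t, ht⟩ := M.exists_drift_eq_of_ge (M.rightEnd_le hle hz) (M.lt_rightEnd h.1)
    exact M.hitTime_ne_top_of_drift (t := t) (by rw [ht]; exact h.2.2)

/-- Strict on the left because the hit point is in `G` and the end is not; strict on the right
because the long-run belief is not reached in finite time. -/
theorem hitPoint_leftEnd_mem (hπ : M.longRunBelief ∈ M.grossRegion)
    (h : M.hitTime (M.leftEnd M.longRunBelief) ≠ ⊤) :
    M.leftEnd M.longRunBelief < M.hitPoint (M.leftEnd M.longRunBelief) ∧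
      M.hitPoint (M.leftEnd M.longRunBelief) < M.longRunBelief := by
  have h1 := M.acqRegion_subset_grossRegion (M.hitPoint_mem h)
  obtain ⟨h2, h3⟩ := M.drift_mem_of_le (M.leftEnd_le M.longRunBelief)
    (M.hitTime (M.leftEnd M.longRunBelief)).toNNReal
  refine ⟨lt_of_le_of_ne h2 fun h4 => M.leftEnd_notMem M.longRunBelief ?_,
    lt_of_le_of_ne h3 fun h4 => (M.leftEnd_lt hπ).ne (M.drift_eq_longRunBelief h4)⟩
  rw [h4]; exact h1

theorem hitPoint_rightEnd_mem (hπ : M.longRunBelief ∈ M.grossRegion)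
    (h : M.hitTime (M.rightEnd M.longRunBelief) ≠ ⊤) :
    M.longRunBelief < M.hitPoint (M.rightEnd M.longRunBelief) ∧
      M.hitPoint (M.rightEnd M.longRunBelief) < M.rightEnd M.longRunBelief := by
  have h1 := M.acqRegion_subset_grossRegion (M.hitPoint_mem h)
  obtain ⟨h2, h3⟩ := M.drift_mem_of_ge (M.le_rightEnd M.longRunBelief)
    (M.hitTime (M.rightEnd M.longRunBelief)).toNNReal
  refine ⟨lt_of_le_of_ne h2 fun h4 =>
      (M.lt_rightEnd hπ).ne' (M.drift_eq_longRunBelief h4.symm),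
    lt_of_le_of_ne h3 fun h4 => M.rightEnd_notMem M.longRunBelief ?_⟩
  rw [← h4]; exact h1

theorem ends_hitPoint_leftEnd (hπ : M.longRunBelief ∈ M.grossRegion)
    (h : M.hitTime (M.leftEnd M.longRunBelief) ≠ ⊤) :
    M.leftEnd (M.hitPoint (M.leftEnd M.longRunBelief)) = M.leftEnd M.longRunBelief ∧
      M.rightEnd (M.hitPoint (M.leftEnd M.longRunBelief)) = M.rightEnd M.longRunBelief := by
  obtain ⟨h1, h2⟩ := hitPoint_leftEnd_mem hπ h
  have h3 := h2.trans (M.lt_rightEnd hπ)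
  exact ⟨M.leftEnd_eq_of_mem_Ioo ⟨h1, h3⟩, M.rightEnd_eq_of_mem_Ioo ⟨h1, h3⟩⟩

theorem ends_hitPoint_rightEnd (hπ : M.longRunBelief ∈ M.grossRegion)
    (h : M.hitTime (M.rightEnd M.longRunBelief) ≠ ⊤) :
    M.leftEnd (M.hitPoint (M.rightEnd M.longRunBelief)) = M.leftEnd M.longRunBelief ∧
      M.rightEnd (M.hitPoint (M.rightEnd M.longRunBelief)) = M.rightEnd M.longRunBelief := by
  obtain ⟨h1, h2⟩ := hitPoint_rightEnd_mem hπ h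
  have h3 := (M.leftEnd_lt hπ).trans h1
  exact ⟨M.leftEnd_eq_of_mem_Ioo ⟨h3, h2⟩, M.rightEnd_eq_of_mem_Ioo ⟨h3, h2⟩⟩

/-- The belief cycle around the long-run belief. -/
def HasCycle.cycle (hc : M.HasCycle) : BeliefCycle M where
  q := ![M.leftEnd M.longRunBelief, M.rightEnd M.longRunBelief]
  p := ![M.hitPoint (M.leftEnd M.longRunBelief), M.hitPoint (M.rightEnd M.longRunBelief)]
  s := ![(M.hitTime (M.leftEnd M.longRunBelief)).toNNReal,
    (M.hitTime (M.rightEnd M.longRunBelief)).toNNReal]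
  q0_lt_p0 := (hitPoint_leftEnd_mem hc.1 hc.2.1).1
  p0_lt := (hitPoint_leftEnd_mem hc.1 hc.2.1).2
  lt_p1 := (hitPoint_rightEnd_mem hc.1 hc.2.2).1
  p1_lt_q1 := (hitPoint_rightEnd_mem hc.1 hc.2.2).2
  drift_eq := fun i => by fin_cases i <;> rfl

/-- Away from the component around the long-run belief, both ends lie between the current posterior
and the long-run belief. -/
theorem eq_or_abs_sub_longRun_lt {e z : Belief} (he : e ∉ M.grossRegion) (hhit : M.hitTime e ≠ ⊤)
    (hπ : M.longRunBelief ∉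
      Set.Ioo (M.leftEnd (M.hitPoint e)) (M.rightEnd (M.hitPoint e)))
    (hz : z = M.leftEnd (M.hitPoint e) ∨ z = M.rightEnd (M.hitPoint e)) :
    z = e ∨ |(z : ℝ) - M.longRun| < |(e : ℝ) - M.longRun| := by
  have hx := M.mem_Ioo_ends (M.acqRegion_subset_grossRegion (M.hitPoint_mem hhit))
  rcases le_total e M.longRunBelief with hle | hle
  · obtain ⟨h1, h2⟩ := M.drift_mem_of_le hle (M.hitTime e).toNNReal
    have hea : e ≤ M.leftEnd (M.hitPoint e) := M.le_leftEnd h1 he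
    have hb : M.rightEnd (M.hitPoint e) ≤ M.longRunBelief := by
      by_contra hb
      exact hπ ⟨hx.1.trans_le h2, not_le.1 hb⟩
    have hez : e ≤ z := by
      rcases hz with rfl | rfl
      · exact hea
      · exact hea.trans (hx.1.trans hx.2).le
    have hzπ : (z : ℝ) ≤ M.longRun := by
      rcases hz with rfl | rfl
      · exact ((hx.1.trans hx.2).le.trans hb : _ ≤ M.longRunBelief)
      · exact hb
    rcases eq_or_lt_of_le hez with h | h
    · exact Or.inl h.symm
    · right
      have h : (e : ℝ) < z := h
      rw [abs_of_nonpos (by linarith), abs_of_nonpos (by linarith)]; linarith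
  · obtain ⟨h1, h2⟩ := M.drift_mem_of_ge hle (M.hitTime e).toNNReal
    have hea : M.rightEnd (M.hitPoint e) ≤ e := M.rightEnd_le h2 he
    have hb : M.longRunBelief ≤ M.leftEnd (M.hitPoint e) := by
      by_contra hb
      exact hπ ⟨not_le.1 hb, h1.trans_lt hx.2⟩
    have hez : z ≤ e := by
      rcases hz with rfl | rfl
      · exact (hx.1.trans hx.2).le.trans hea
      · exact hea
    have hzπ : M.longRun ≤ (z : ℝ) := by
      rcases hz with rfl | rfl
      · exact hb
      · exact (hb.trans (hx.1.trans hx.2).le : M.longRunBelief ≤ _)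
    rcases eq_or_lt_of_le hez with h | h
    · exact Or.inl h
    · right
      have h : (z : ℝ) < e := h
      rw [abs_of_nonneg (by linarith), abs_of_nonneg (by linarith)]; linarith

/-- The pathwise core: a sequence that never stops either gets stuck at a target or meets the
component of the long-run belief. In the latter case a non-returning end cannot occur, so without a
cycle the sequence is again stuck. -/
theorem eventually_eq_or_hasCycle {ω : ℕ → Belief} (hhit : ∀ n, M.hitTime (ω n) ≠ ⊤)
    (hstep : ∀ n, ω (n + 1) = M.leftEnd (M.hitPoint (ω n)) ∨
      ω (n + 1) = M.rightEnd (M.hitPoint (ω n))) :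
    (∃ N, ω N ∈ M.leftEnd '' M.acqRegion ∪ M.rightEnd '' M.acqRegion ∧ ∀ n, N ≤ n → ω n = ω N) ∨
    (M.HasCycle ∧ ∃ n, ω n = M.leftEnd M.longRunBelief ∨ ω n = M.rightEnd M.longRunBelief) := by
  have hE : ∀ n, ω (n + 1) ∈ M.leftEnd '' M.acqRegion ∪ M.rightEnd '' M.acqRegion := fun n => by
    rcases hstep n with h | h <;> rw [h]
    · exact Or.inl ⟨_, M.hitPoint_mem (hhit n), rfl⟩
    · exact Or.inr ⟨_, M.hitPoint_mem (hhit n), rfl⟩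
  have hG : ∀ n, ω (n + 1) ∉ M.grossRegion := fun n => by
    rcases hstep n with h | h <;> rw [h]
    · exact M.leftEnd_notMem _
    · exact M.rightEnd_notMem _
  by_cases hπ : ∃ n, M.longRunBelief ∈
      Set.Ioo (M.leftEnd (M.hitPoint (ω n))) (M.rightEnd (M.hitPoint (ω n)))
  · obtain ⟨n, hn⟩ := hπ
    have hπG := M.mem_grossRegion_of_mem_Ioo hn
    have hs := hstep n
    rw [← M.leftEnd_eq_of_mem_Ioo hn, ← M.rightEnd_eq_of_mem_Ioo hn] at hs
    by_cases hc : M.HasCycle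
    · exact Or.inr ⟨hc, n + 1, hs⟩
    -- The end just drawn leads back to the region, so the other one does not. Drawing the other
    -- would contradict `hhit`, which leaves a constant sequence.
    left
    refine ⟨n + 1, hE n, fun m hm => ?_⟩
    rcases hs with hs | hs
    · have hl : M.hitTime (M.leftEnd M.longRunBelief) ≠ ⊤ := hs ▸ hhit (n + 1)
      have hr : M.hitTime (M.rightEnd M.longRunBelief) = ⊤ := by
        by_contra hr; exact hc ⟨hπG, hl, hr⟩
      induction m, hm using Nat.le_induction with
      | base => rfl
      | succ m _ ih =>
        obtain ⟨e1, e2⟩ := ends_hitPoint_leftEnd hπG hl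
        have h2 := hstep m
        rw [ih, hs, e1, e2] at h2
        rcases h2 with h2 | h2
        · rw [h2, hs]
        · exact absurd hr (h2 ▸ hhit (m + 1))
    · have hr : M.hitTime (M.rightEnd M.longRunBelief) ≠ ⊤ := hs ▸ hhit (n + 1)
      have hl : M.hitTime (M.leftEnd M.longRunBelief) = ⊤ := by
        by_contra hl; exact hc ⟨hπG, hl, hr⟩
      induction m, hm using Nat.le_induction with
      | base => rfl
      | succ m _ ih =>
        obtain ⟨e1, e2⟩ := ends_hitPoint_rightEnd hπG hr
        have h2 := hstep m
        rw [ih, hs, e1, e2] at h2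
        rcases h2 with h2 | h2
        · exact absurd hl (h2 ▸ hhit (m + 1))
        · rw [h2, hs]
  · left
    push Not at hπ
    have hdec : ∀ n, ω (n + 1 + 1) = ω (n + 1) ∨
        |(ω (n + 1 + 1) : ℝ) - M.longRun| < |(ω (n + 1) : ℝ) - M.longRun| := fun n =>
      eq_or_abs_sub_longRun_lt (hG n) (hhit _) (hπ _) (hstep _)
    -- Shifted by one, since the initial belief need not be a target and may lie in `G`.
    set D : ℕ → ℝ := fun n => |(ω (n + 1) : ℝ) - M.longRun| with hD
    have hanti : Antitone D := antitone_nat_of_succ_le fun n => by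
      rcases hdec n with h | h
      · simp only [hD, h, le_refl]
      · exact h.le
    have hfin : (Set.range D).Finite := by
      refine (M.finite_ends.image fun q : Belief => |(q : ℝ) - M.longRun|).subset ?_
      rintro _ ⟨n, rfl⟩
      exact ⟨ω (n + 1), hE n, rfl⟩
    -- Once the minimal distance is attained no strict drop is left, so the posterior must repeat.
    obtain ⟨_, ⟨N, rfl⟩, hN⟩ := hfin.exists_minimal (Set.range_nonempty D)
    refine ⟨N + 1, hE N, fun n hn => ?_⟩
    induction n, hn using Nat.le_induction with
    | base => rfl
    | succ n hn ih =>
      obtain ⟨k, rfl⟩ : ∃ k, n = k + 1 := ⟨n - 1, by omega⟩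
      rcases hdec k with h | h
      · rw [h, ih]
      · have h1 : D N ≤ D (k + 1) := hN ⟨k + 1, rfl⟩ (hanti (by omega))
        have h2 : D k ≤ D N := hanti (by omega)
        have h3 : D (k + 1) < D k := h
        linarith

end Model

/-! ### Stopping, entering the cycle, and the random time. -/

namespace Policy

variable {M : Model} {ξ : Policy M}

theorem IsOptimalRule.acqTime_succ (hξ : ξ.IsOptimalRule) (n : ℕ) (ω : ℕ → Belief) :
    ξ.acqTime (n + 1) ω = ξ.acqTime n ω + M.hitTime (ω n) := by
  rw [Policy.acqTime_succ, hξ.wait_eq]; rfl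

theorem IsOptimalRule.acqTime_ne_top (hξ : ξ.IsOptimalRule) {ω : ℕ → Belief} {n : ℕ}
    (h : ∀ k < n, M.hitTime (ω k) ≠ ⊤) : ξ.acqTime n ω ≠ ⊤ := by
  induction n with
  | zero => simp [acqTime]
  | succ n ih =>
    rw [hξ.acqTime_succ]
    exact ENNReal.add_ne_top.2 ⟨ih fun k hk => h k (by omega), h n (by omega)⟩

/-- Almost surely, the belief sequence reaches a posterior after which no information is acquired,
or the ends of the component around the long-run belief. -/
theorem IsOptimalRule.ae_exists (hξ : ξ.IsOptimalRule) (p : Belief) :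
    ∀ᵐ ω ∂(ξ.law p), (∃ n, M.hitTime (ω n) = ⊤) ∨
      (M.HasCycle ∧
        ∃ n, ω n = M.leftEnd M.longRunBelief ∨ ω n = M.rightEnd M.longRunBelief) := by
  -- The set of targets is countable, so one null set serves for all of them.
  have h1 : ∀ᵐ ω ∂(ξ.law p), ∀ e ∈ M.leftEnd '' M.acqRegion ∪ M.rightEnd '' M.acqRegion,
      M.hitTime e ≠ ⊤ → ¬∃ N, ∀ n, N ≤ n → ω n = e := by
    rw [ae_ball_iff M.finite_ends.countable]
    intro e _
    by_cases he : M.hitTime e = ⊤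
    · exact ae_of_all _ fun ω h => absurd he h
    · filter_upwards [hξ.ae_not_eventually_eq p he] with ω hω _ using hω
  filter_upwards [h1, hξ.ae_step p] with ω h2 hstep
  by_cases hhit : ∃ n, M.hitTime (ω n) = ⊤
  · exact Or.inl hhit
  push Not at hhit
  rcases Model.eventually_eq_or_hasCycle hhit fun n => hstep n (hhit n) with ⟨N, hN, h⟩ | h
  · exact absurd ⟨N, h⟩ (h2 _ hN (hhit N))
  · exact Or.inr h

/-- Every posterior after the first acquisition lies outside `G`, so with a cycle the process can
fail to continue only at its initial belief. -/
theorem IsOptimalRule.ae_hitTime_ne_top (hξ : ξ.IsOptimalRule) {p : Belief} (hc : M.HasCycle)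
    (hp : M.hitTime p ≠ ⊤) : ∀ᵐ ω ∂(ξ.law p), ∀ n, M.hitTime (ω n) ≠ ⊤ := by
  filter_upwards [ξ.law_start p, hξ.ae_step p] with ω h0 hstep n
  induction n with
  | zero => rwa [h0]
  | succ n ih =>
    rcases hstep n ih with h | h <;> rw [h]
    · exact hc.hitTime_ne_top (M.leftEnd_notMem _)
    · exact hc.hitTime_ne_top (M.rightEnd_notMem _)

/-- The time of the last acquisition. -/
def lastAcqTime (ξ : Policy M) (ω : ℕ → Belief) : ℝ≥0∞ :=
  ⨆ n, if ξ.acqTime n ω < ⊤ then ξ.acqTime n ω else 0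

theorem measurable_lastAcqTime (ξ : Policy M) : Measurable ξ.lastAcqTime :=
  .iSup fun n => Measurable.ite (measurableSet_lt (ξ.measurable_acqTime n) measurable_const)
    (ξ.measurable_acqTime n) measurable_const

theorem IsOptimalRule.stopsAfter_lastAcqTime (hξ : ξ.IsOptimalRule) {ω : ℕ → Belief}
    (h : ∃ n, M.hitTime (ω n) = ⊤) : ξ.lastAcqTime ω < ⊤ ∧
      ξ.StopsAfter (ξ.lastAcqTime ω) ω ∧
      Tendsto (fun t : ℝ≥0 => (ξ.belief ω t : ℝ)) atTop (𝓝 M.longRun) := by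
  classical
  set N := Nat.find h with hN
  have hNtop : M.hitTime (ω N) = ⊤ := Nat.find_spec h
  have hlt : ξ.acqTime N ω ≠ ⊤ := hξ.acqTime_ne_top fun k hk => Nat.find_min h hk
  have hsucc : ξ.acqTime (N + 1) ω = ⊤ := by rw [hξ.acqTime_succ, hNtop, add_top]
  have hT : ξ.lastAcqTime ω = ξ.acqTime N ω := by
    refine le_antisymm (iSup_le fun n => ?_) ?_
    · split_ifs with hn
      · refine ξ.acqTime_mono ω ?_
        by_contra hNn
        have := ξ.acqTime_mono ω (show N + 1 ≤ n by omega)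
        simp only [hsucc] at this
        exact absurd hn (not_lt.2 this)
      · exact zero_le
    · exact le_iSup_of_le N (by rw [if_pos hlt.lt_top])
  refine ⟨hT ▸ hlt.lt_top, ⟨N, hT.ge, hsucc⟩, ?_⟩
  set c := (ξ.acqTime N ω).toNNReal with hc
  have h1 : Tendsto (fun t : ℝ≥0 => t - c) atTop atTop := 
    tendsto_atTop.2 fun d => (eventually_ge_atTop (d + c)).mono fun _ => le_tsub_of_add_le_right
  refine ((M.tendsto_drift (ω N)).comp h1).congr' ?_
  filter_upwards [eventually_ge_atTop c] with t ht
  have h2 : ξ.acqTime N ω ≤ t := by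
    rw [← ENNReal.coe_toNNReal hlt]; exact ENNReal.coe_le_coe.2 ht
  rw [Function.comp, ξ.belief_eq h2 (by rw [hsucc]; exact ENNReal.coe_lt_top)]

open Classical in
/-- The first time at which the belief is an end of the component around the long-run belief. -/
def cycleTime (ξ : Policy M) (ω : ℕ → Belief) : ℝ≥0∞ :=
  ⨅ n, if ω n = M.leftEnd M.longRunBelief ∨ ω n = M.rightEnd M.longRunBelief then
    ξ.acqTime n ω else ⊤

theorem measurable_cycleTime (ξ : Policy M) : Measurable ξ.cycleTime := by
  classical
  refine .iInf fun n => Measurable.ite ?_ (ξ.measurable_acqTime n) measurable_const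
  have h : Measurable fun ω : ℕ → Belief => ω n := measurable_pi_apply n
  exact (h (measurableSet_singleton _)).union (h (measurableSet_singleton _))

/-- The hit point from either end stays in the component of the long-run belief, so the pair of ends
is absorbing. -/
theorem IsOptimalRule.followsCycleFrom_cycleTime (hξ : ξ.IsOptimalRule) (hc : M.HasCycle)
    {ω : ℕ → Belief} (hhit : ∀ n, M.hitTime (ω n) ≠ ⊤)
    (hstep : ∀ n, ω (n + 1) = M.leftEnd (M.hitPoint (ω n)) ∨
      ω (n + 1) = M.rightEnd (M.hitPoint (ω n)))
    (h : ∃ n, ω n = M.leftEnd M.longRunBelief ∨ ω n = M.rightEnd M.longRunBelief) :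
    ξ.cycleTime ω < ⊤ ∧ ξ.FollowsCycleFrom hc.cycle (ξ.cycleTime ω) ω := by
  classical
  obtain ⟨l1, l2⟩ := Model.ends_hitPoint_leftEnd hc.1 hc.2.1
  obtain ⟨r1, r2⟩ := Model.ends_hitPoint_rightEnd hc.1 hc.2.2
  set N := Nat.find h with hN
  have hfin : ∀ n, ξ.acqTime n ω ≠ ⊤ := fun n => hξ.acqTime_ne_top fun k _ => hhit k
  have hT : ξ.cycleTime ω = ξ.acqTime N ω := by
    refine le_antisymm (iInf_le_of_le N (by rw [if_pos (Nat.find_spec h)])) (le_iInf fun n => ?_)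
    split_ifs with hn
    · exact ξ.acqTime_mono ω (Nat.find_min' h hn)
    · exact le_top
  have hmem : ∀ n, N ≤ n → ω n = M.leftEnd M.longRunBelief ∨
      ω n = M.rightEnd M.longRunBelief := by
    intro n hn
    induction n, hn using Nat.le_induction with
    | base => exact Nat.find_spec h
    | succ n _ ih =>
      have := hstep n
      rcases ih with h1 | h1 <;> rw [h1] at this
      · rwa [l1, l2] at this
      · rwa [r1, r2] at this
  refine ⟨hT ▸ (hfin N).lt_top, N, hT.symm, hT ▸ hfin N, fun n hn => ?_⟩
  have hbin := hξ.isBinaryExperiment (h := hist ω n) (hhit n)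
  have hlast : (hist ω n).last = ω n := rfl
  rw [hlast] at hbin
  have hsucc : ξ.acqTime (n + 1) ω =
      ξ.acqTime n ω + ((M.hitTime (ω n)).toNNReal : ℝ≥0∞) := by
    rw [hξ.acqTime_succ, ENNReal.coe_toNNReal (hhit n)]
  have hbel : ∀ t : ℝ≥0, t < (M.hitTime (ω n)).toNNReal →
      ξ.belief ω ((ξ.acqTime n ω).toNNReal + t) = M.drift (ω n) t := by
    intro t ht
    have e1 : (((ξ.acqTime n ω).toNNReal + t : ℝ≥0) : ℝ≥0∞) = ξ.acqTime n ω + t := by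
      rw [ENNReal.coe_add, ENNReal.coe_toNNReal (hfin n)]
    rw [ξ.belief_eq (n := n) (by rw [e1]; exact le_self_add) (by
      rw [e1, hsucc]
      exact ENNReal.add_lt_add_left (hfin n) (ENNReal.coe_lt_coe.2 ht)), add_tsub_cancel_left]
  rcases hmem n hn with h1 | h1
  · rw [h1] at hbel hsucc hbin
    rw [l1, l2] at hbin
    exact ⟨0, hbel, hsucc, hbin⟩
  · rw [h1] at hbel hsucc hbin
    rw [r1, r2] at hbin
    exact ⟨1, hbel, hsucc, hbin⟩

end Policy

end InfoAcq

end

theorem theorem3 (M : InfoAcq.Model) :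
    (∃ ξ : InfoAcq.Policy M, ξ.IsOptimalRule) ∧
    ∀ ξ : InfoAcq.Policy M, ξ.IsOptimalRule → ∀ p : InfoAcq.Belief,
      ∃ T : (ℕ → InfoAcq.Belief) → ℝ≥0∞, Measurable T ∧ (∀ᵐ ω ∂(ξ.law p), T ω < ⊤) ∧
        ((∀ᵐ ω ∂(ξ.law p), ξ.StopsAfter (T ω) ω ∧
            Tendsto (fun t : ℝ≥0 => (ξ.belief ω t : ℝ)) atTop (𝓝 M.longRun)) ∨
          ∃ C : InfoAcq.BeliefCycle M, ∀ᵐ ω ∂(ξ.law p), ξ.FollowsCycleFrom C (T ω) ω) := by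
  refine ⟨⟨M.optimalPolicy, M.isOptimalRule_optimalPolicy⟩, fun ξ hξ p => ?_⟩
  -- This condition depends on the model and `p` alone, so one alternative and one cycle hold for
  -- almost all realizations.
  by_cases hc : M.HasCycle ∧ M.hitTime p ≠ ⊤
  · have h : ∀ᵐ ω ∂(ξ.law p), ξ.cycleTime ω < ⊤ ∧
        ξ.FollowsCycleFrom hc.1.cycle (ξ.cycleTime ω) ω := by
      filter_upwards [hξ.ae_exists p, hξ.ae_step p, hξ.ae_hitTime_ne_top hc.1 hc.2]
        with ω h1 hstep hhit
      refine hξ.followsCycleFrom_cycleTime hc.1 hhit (fun n => hstep n (hhit n)) ?_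
      rcases h1 with ⟨n, hn⟩ | h1
      · exact absurd hn (hhit n)
      · exact h1.2
    exact ⟨ξ.cycleTime, ξ.measurable_cycleTime, h.mono fun _ hω => hω.1,
      Or.inr ⟨hc.1.cycle, h.mono fun _ hω => hω.2⟩⟩
  · have h : ∀ᵐ ω ∂(ξ.law p), ξ.lastAcqTime ω < ⊤ ∧ ξ.StopsAfter (ξ.lastAcqTime ω) ω ∧
        Tendsto (fun t : ℝ≥0 => (ξ.belief ω t : ℝ)) atTop (𝓝 M.longRun) := by
      filter_upwards [hξ.ae_exists p, ξ.law_start p] with ω h1 h0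
      refine hξ.stopsAfter_lastAcqTime ?_
      rcases h1 with h1 | h1
      · exact h1
      -- Here a cycle exists, so the case hypothesis leaves only that nothing is ever acquired from
      -- `p`.
      · refine ⟨0, ?_⟩
        rw [h0]
        by_contra hp
        exact hc ⟨h1.1, hp⟩
    exact ⟨ξ.lastAcqTime, ξ.measurable_lastAcqTime, h.mono fun _ hω => hω.1,
      Or.inl (h.mono fun _ hω => hω.2)⟩
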